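/- Let $n, m, t$ be non-negative integers with $m \le n$. The generalized Hilbert–Schmidt ensemble $\eta_{n,m}$ is the random $n$-qubit state $\operatorname{tr}_m(|\psi\rangle\langle\psi|)$ obtained by tracing out the last $m$ qubits of a Haar random pure state $|\psi\rangle$ of $n+m$ qubits. The ensemble $\zeta_{n,m}$ is the random $n$-qubit state $U\big((|0\rangle\langle 0|)^{\otimes (n-m)} \otimes \sigma_m\big)U^\dagger$, where $U$ is a Haar random unitary on $n$ qubits and $\sigma_m = I_m/2^m$ is the maximally mixed state of $m$ qubits. Let $\|A\|_1 = \operatorname{tr}\sqrt{A^\dagger A}$ denote the trace norm. Lemma. One has $$\left\| \mathop{\mathbb{E}}_{\rho \leftarrow \eta_{n,m}}\big[\rho^{\otimes t}\big] - \mathop{\mathbb{E}}_{\rho' \leftarrow \zeta_{n,m}}\big[\rho'^{\otimes t}\big] \right\|_1 = O\!\left(\frac{t^2}{2^n}\right)$$ with an absolute implied constant: there is a constant $C > 0$ such that for all $n, m, t$ with $m \le n$ the left-hand side is at most $C\, t^2/2^n$. -/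

import Mathlib

open MeasureTheory
open scoped Kronecker

/-! ### Qubit registers -/

/-- Labels of the computational basis of an `n`-qubit register: bit strings of length `n`. -/
abbrev Qubits (n : ℕ) : Type := Fin n → Fin 2

/-- Operators on `n` qubits, as matrices in the computational basis. -/
abbrev QubitOp (n : ℕ) : Type := Matrix (Qubits n) (Qubits n) ℂ

/-- Cut a register of `a + b` qubits into its first `a` and its last `b` qubits. -/
def splitQubits (a b : ℕ) : Qubits (a + b) ≃ Qubits a × Qubits b :=
  (Fin.appendEquiv a b).symm

/-- The computational basis vector `|0…0⟩` of `n` qubits. -/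
def zeroKet (n : ℕ) : Qubits n → ℂ := Pi.single 0 1

/-- The rank-one operator `|ψ⟩⟨ψ|`. -/
def ketbra {n : ℕ} (ψ : Qubits n → ℂ) : QubitOp n := Matrix.vecMulVec ψ (star ψ)

/-- The maximally mixed state `I / 2^m` of `m` qubits. -/
noncomputable def maxMixed (m : ℕ) : QubitOp m := ((2 : ℂ) ^ m)⁻¹ • 1

/-- Tensor product of operators on registers of `a` and `b` qubits. -/
def tensorOp {a b : ℕ} (A : QubitOp a) (B : QubitOp b) : QubitOp (a + b) :=
  (A ⊗ₖ B).submatrix (splitQubits a b) (splitQubits a b)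

/-- Partial trace over the last `b` of `a + b` qubits. -/
def partialTraceLast (a b : ℕ) (A : QubitOp (a + b)) : QubitOp a :=
  Matrix.of fun x y => ∑ z : Qubits b,
    A ((splitQubits a b).symm (x, z)) ((splitQubits a b).symm (y, z))

/-- The state `(|0⟩⟨0|)^{⊗ (n - m)} ⊗ σ_m` of `n` qubits, where `m ≤ n`. -/
noncomputable def flatState (n m : ℕ) (h : m ≤ n) : QubitOp n :=
  (tensorOp (ketbra (zeroKet (n - m))) (maxMixed m)).submatrix
    (fun x i => x (Fin.cast (Nat.sub_add_cancel h) i))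
    (fun x i => x (Fin.cast (Nat.sub_add_cancel h) i))

/-- The tensor power `A^{⊗ t}` on the `t`-fold tensor product, whose basis is labelled by
`t`-tuples of basis labels. -/
def tensorPow {ι : Type*} (t : ℕ) (A : Matrix ι ι ℂ) : Matrix (Fin t → ι) (Fin t → ι) ℂ :=
  Matrix.of fun x y => ∏ k, A (x k) (y k)

/-- The trace norm `‖A‖₁ = tr √(Aᴴ A)`: the sum of the singular values of `A`, that is, of the
square roots of the eigenvalues (with multiplicity) of `Aᴴ A`. -/
noncomputable def traceNorm {ι : Type*} [Fintype ι] [DecidableEq ι] (A : Matrix ι ι ℂ) : ℝ :=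
  ∑ i, Real.sqrt ((Matrix.isHermitian_conjTranspose_mul_self A).eigenvalues i)

/-! ### Haar measure -/

section Haar

variable {ι κ : Type*} [Fintype ι] [Fintype κ]

/-- The entrywise (product) σ-algebra on complex matrices. -/
noncomputable instance instMeasurableSpaceComplexMatrix : MeasurableSpace (Matrix ι κ ℂ) :=
  inferInstanceAs (MeasurableSpace (ι → κ → ℂ))

instance instBorelSpaceComplexMatrix : BorelSpace (Matrix ι κ ℂ) :=
  inferInstanceAs (BorelSpace (ι → κ → ℂ))

variable [DecidableEq ι]

instance instCompactSpaceUnitaryGroup : CompactSpace (Matrix.unitaryGroup ι ℂ) := by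
  suffices h : IsCompact (Matrix.unitaryGroup ι ℂ : Set (Matrix ι ι ℂ)) from
    isCompact_iff_compactSpace.mp h
  have hK : IsCompact (Set.pi Set.univ fun _ : ι => Set.pi Set.univ fun _ : ι =>
      Metric.closedBall (0 : ℂ) 1) :=
    isCompact_univ_pi fun _ => isCompact_univ_pi fun _ => isCompact_closedBall _ _
  refine hK.of_isClosed_subset (isClosed_unitary (R := Matrix ι ι ℂ)) ?_
  intro U hU i _ j _
  simpa using entry_norm_bound_of_unitary hU i j

variable (ι) in
/-- The Haar probability measure on the unitary group. -/
noncomputable def haarUnitary : Measure (Matrix.unitaryGroup ι ℂ) :=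
  Measure.haarMeasure ⊤

instance instIsProbabilityMeasureHaarUnitary : IsProbabilityMeasure (haarUnitary ι) :=
  ⟨by simpa [haarUnitary] using
    Measure.haarMeasure_self (K₀ := (⊤ : TopologicalSpace.PositiveCompacts
      (Matrix.unitaryGroup ι ℂ)))⟩

end Haar

/-! ### The two ensembles, as probability distributions over operators on `n` qubits -/

/-- The Haar measure over pure states of `n` qubits: the law of `U |0…0⟩` for a Haar random
unitary `U`. -/
noncomputable def haarState (n : ℕ) : Measure (Qubits n → ℂ) :=
  (haarUnitary (Qubits n)).map fun U : Matrix.unitaryGroup (Qubits n) ℂ =>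
    (U : QubitOp n).mulVec (zeroKet n)

/-- The generalized Hilbert–Schmidt ensemble `η_{n,m}`: the law of `tr_m |ψ⟩⟨ψ|` for a Haar
random state `ψ` of `n + m` qubits. -/
noncomputable def ghse (n m : ℕ) : Measure (QubitOp n) :=
  (haarState (n + m)).map fun ψ => partialTraceLast n m (ketbra ψ)

/-- The ensemble `ζ_{n,m}`: the law of `U ((|0⟩⟨0|)^{⊗ (n - m)} ⊗ σ_m) U†` for a Haar random
unitary `U` on `n` qubits. -/
noncomputable def flatEnsemble (n m : ℕ) (h : m ≤ n) : Measure (QubitOp n) :=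
  (haarUnitary (Qubits n)).map fun U : Matrix.unitaryGroup (Qubits n) ℂ =>
    (U : QubitOp n) * flatState n m h * (U : QubitOp n).conjTranspose

/-- The `t`-copy moment operator `𝔼_{ρ ← ν} [ρ^{⊗ t}]` of an ensemble `ν` (entrywise
expectation). -/
noncomputable def momentOp {n : ℕ} (t : ℕ) (ν : Measure (QubitOp n)) :
    Matrix (Fin t → Qubits n) (Fin t → Qubits n) ℂ :=
  Matrix.of fun x y => ∫ ρ, tensorPow t ρ x y ∂ν

/-! The maps above are measurable, so the push-forwards are genuine probability measures. -/

lemma measurable_haarState_map (n : ℕ) : Measurable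
    fun U : Matrix.unitaryGroup (Qubits n) ℂ => (U : QubitOp n).mulVec (zeroKet n) :=
  (Continuous.matrix_mulVec continuous_subtype_val continuous_const).measurable

lemma measurable_ghse_map (n m : ℕ) : Measurable
    fun ψ : Qubits (n + m) → ℂ => partialTraceLast n m (ketbra ψ) := by
  refine measurable_pi_lambda _ fun x => measurable_pi_lambda _ fun y => ?_
  simp only [partialTraceLast, ketbra, Matrix.of_apply, Matrix.vecMulVec_apply, Pi.star_apply]
  exact Continuous.measurable (by fun_prop)

lemma measurable_flatEnsemble_map (n m : ℕ) (h : m ≤ n) : Measurable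
    fun U : Matrix.unitaryGroup (Qubits n) ℂ =>
      (U : QubitOp n) * flatState n m h * (U : QubitOp n).conjTranspose :=
  Continuous.measurable <| (continuous_subtype_val.matrix_mul continuous_const).matrix_mul
    continuous_subtype_val.matrix_conjTranspose

instance instIsProbabilityMeasureHaarState (n : ℕ) : IsProbabilityMeasure (haarState n) :=
  Measure.isProbabilityMeasure_map (measurable_haarState_map n).aemeasurable

instance instIsProbabilityMeasureGhse (n m : ℕ) : IsProbabilityMeasure (ghse n m) :=
  Measure.isProbabilityMeasure_map (measurable_ghse_map n m).aemeasurable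

instance instIsProbabilityMeasureFlatEnsemble (n m : ℕ) (h : m ≤ n) :
    IsProbabilityMeasure (flatEnsemble n m h) :=
  Measure.isProbabilityMeasure_map (measurable_flatEnsemble_map n m h).aemeasurable

/-! Put `N = 2 ^ n` and `M = 2 ^ m`. Reshape the Haar vector `ψ` into an `N × M` matrix `G`, so that
the reduced state is `G Gᴴ`. Its law is invariant under unitary conjugation, so it may be twirled by
an independent Haar unitary `W`. The twirl sees only the spectrum, so `G Gᴴ` may be replaced by `P
(Gᴴ G) Pᴴ`, with `P` a coordinate embedding of `ℂ^M` into `ℂ^N`; this is where `m ≤ n` enters. The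
ensemble `ζ` is the twirl of `P (1/M) Pᴴ`. The problem thus moves to the small register: compare `𝔼
(Gᴴ G)^{⊗ t}` with `(1/M)^{⊗ t}`.

By duality the trace norm is tested against a unitary `S`. Conjugated by `W^{⊗ t}`, `S` stays
unitary and its entries have modulus at most one, so the entrywise `ℓ¹` distance of the two `M^t ×
M^t` matrices is enough (`norm_integral_trace_sub_le`).

The moments of a Haar vector (`columnMoment_eq`) make the entries of `𝔼 (Gᴴ G)^{⊗ t}` nonnegative
and explicit. With `D = NM(NM+1)⋯(NM+t-1)`, they sum to `M^t N(N+1)⋯(N+t-1) / D`, and each diagonal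
entry is at least `N^t / D`. Both `M^t N^t / D` and the full sum are `1 + O(t²/N)` when `t² ≤ N`, so
the `ℓ¹` distance is `O(t²/N)` (`sum_norm_reducedMoment_sub_le`). For `t² > N` the trivial bound 2
suffices. -/

/-! ### Tensor powers -/

section TensorPow

variable {ι : Type*}

lemma tensorPow_apply (t : ℕ) (A : Matrix ι ι ℂ) (x y : Fin t → ι) :
    tensorPow t A x y = ∏ k, A (x k) (y k) := rfl

lemma tensorPow_conjTranspose (t : ℕ) (A : Matrix ι ι ℂ) :
    tensorPow t A.conjTranspose = (tensorPow t A).conjTranspose := by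
  ext x y
  simp [tensorPow_apply, Matrix.conjTranspose_apply]

lemma tensorPow_diagonal [DecidableEq ι] (t : ℕ) (d : ι → ℂ) :
    tensorPow t (Matrix.diagonal d) = Matrix.diagonal fun x => ∏ k, d (x k) := by
  ext x y
  rw [tensorPow_apply]
  by_cases h : x = y
  · simp [h]
  · obtain ⟨k, hk⟩ := Function.ne_iff.mp h
    rw [Matrix.diagonal_apply_ne _ h]
    exact Finset.prod_eq_zero (Finset.mem_univ k) (Matrix.diagonal_apply_ne _ hk)

lemma tensorPow_one [DecidableEq ι] (t : ℕ) : tensorPow t (1 : Matrix ι ι ℂ) = 1 := by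
  rw [← Matrix.diagonal_one, tensorPow_diagonal]
  simp

variable [Fintype ι]

lemma tensorPow_mul [DecidableEq ι] (t : ℕ) (A B : Matrix ι ι ℂ) :
    tensorPow t (A * B) = tensorPow t A * tensorPow t B := by
  ext x y
  simp only [tensorPow_apply, Matrix.mul_apply, ← Finset.prod_mul_distrib]
  rw [Finset.prod_univ_sum]
  simp [Fintype.piFinset_univ]

variable [DecidableEq ι]

lemma tensorPow_mem_unitaryGroup (t : ℕ) {U : Matrix ι ι ℂ} (hU : U ∈ Matrix.unitaryGroup ι ℂ) :
    tensorPow t U ∈ Matrix.unitaryGroup (Fin t → ι) ℂ := by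
  rw [Matrix.mem_unitaryGroup_iff, Matrix.star_eq_conjTranspose, ← tensorPow_conjTranspose,
    ← tensorPow_mul, ← Matrix.star_eq_conjTranspose, Matrix.mem_unitaryGroup_iff.mp hU, tensorPow_one]

/-- Conjugation of an observable `S` by `U^{⊗ t}`. -/
def conjTensorPow (t : ℕ) (U : Matrix ι ι ℂ) (S : Matrix (Fin t → ι) (Fin t → ι) ℂ) :
    Matrix (Fin t → ι) (Fin t → ι) ℂ :=
  (tensorPow t U).conjTranspose * S * tensorPow t U

lemma conjTensorPow_mem_unitaryGroup (t : ℕ) {U : Matrix ι ι ℂ}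
    (hU : U ∈ Matrix.unitaryGroup ι ℂ) {S : Matrix (Fin t → ι) (Fin t → ι) ℂ}
    (hS : S ∈ Matrix.unitaryGroup (Fin t → ι) ℂ) :
    conjTensorPow t U S ∈ Matrix.unitaryGroup (Fin t → ι) ℂ := by
  have h := tensorPow_mem_unitaryGroup t hU
  exact mul_mem (mul_mem (Unitary.star_mem h) hS) h

/-- Cyclicity of the trace moves the random unitary from the state to the observable, which remains
unitary. -/
lemma trace_tensorPow_conj_mul (t : ℕ) (U A : Matrix ι ι ℂ)
    (S : Matrix (Fin t → ι) (Fin t → ι) ℂ) :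
    (tensorPow t (U * A * U.conjTranspose) * S).trace =
      (tensorPow t A * conjTensorPow t U S).trace := by
  rw [tensorPow_mul, tensorPow_mul, tensorPow_conjTranspose, conjTensorPow, Matrix.mul_assoc,
    Matrix.mul_assoc, Matrix.trace_mul_comm, Matrix.mul_assoc, Matrix.mul_assoc]

open scoped ComplexOrder in
/-- A state pairs with the tensor power of a unitary observable to a number of modulus
at most one. -/
lemma norm_trace_tensorPow_mul_le_one (t : ℕ) {A : Matrix ι ι ℂ} (hA : A.PosSemidef)
    (htr : A.trace = 1) {S : Matrix (Fin t → ι) (Fin t → ι) ℂ}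
    (hS : S ∈ Matrix.unitaryGroup (Fin t → ι) ℂ) :
    ‖(tensorPow t A * S).trace‖ ≤ 1 := by
  have hsum : ∑ i, hA.1.eigenvalues i = 1 := by
    have := hA.1.trace_eq_sum_eigenvalues
    rw [htr] at this
    simpa using (congrArg Complex.re this).symm
  have hspec := hA.1.spectral_theorem
  rw [Unitary.conjStarAlgAut_apply] at hspec
  rw [hspec, Matrix.star_eq_conjTranspose, trace_tensorPow_conj_mul, tensorPow_diagonal]
  have hK := conjTensorPow_mem_unitaryGroup t hA.1.eigenvectorUnitary.2 hS
  rw [Matrix.trace]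
  simp only [Matrix.diag_apply, Matrix.diagonal_mul]
  -- In the eigenbasis of `A` the trace is an average of diagonal entries of a unitary, weighted by
  -- the product distribution of the eigenvalues.
  calc _ ≤ ∑ x : Fin t → ι, ∏ k, hA.1.eigenvalues (x k) := by
        refine (norm_sum_le _ _).trans (Finset.sum_le_sum fun x _ => ?_)
        rw [norm_mul, norm_prod]
        have h0 : 0 ≤ ∏ k, hA.1.eigenvalues (x k) :=
          Finset.prod_nonneg fun k _ => hA.eigenvalues_nonneg _
        have h1 : ∏ k, ‖(RCLike.ofReal ∘ hA.1.eigenvalues : ι → ℂ) (x k)‖ =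
            ∏ k, hA.1.eigenvalues (x k) := by
          refine Finset.prod_congr rfl fun k _ => ?_
          simp [abs_of_nonneg (hA.eigenvalues_nonneg _)]
        rw [h1]
        exact mul_le_of_le_one_right h0 (entry_norm_bound_of_unitary hK x x)
    _ = (∑ i, hA.1.eigenvalues i) ^ t := by
        rw [Finset.sum_pow', Fintype.piFinset_univ]
    _ = 1 := by rw [hsum, one_pow]

end TensorPow

/-! ### The trace norm of a Hermitian matrix -/

section TraceNorm

variable {ι : Type*} [Fintype ι] [DecidableEq ι]

/-- The roots of the characteristic polynomial agree only as multisets, not index by index; a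
symmetric sum needs no more. -/
lemma sum_comp_eigenvalues_eq_of_charpoly {A : Matrix ι ι ℂ} (hA : A.IsHermitian) {d : ι → ℝ}
    (h : A.charpoly = ∏ i, (Polynomial.X - Polynomial.C (d i : ℂ))) (f : ℝ → ℝ) :
    ∑ i, f (hA.eigenvalues i) = ∑ i, f (d i) := by
  rw [hA.charpoly_eq] at h
  have h2 := congrArg Polynomial.roots h
  have hr : ∀ e : ι → ℝ, (∏ i, (Polynomial.X - Polynomial.C (e i : ℂ))).roots =
      (Finset.univ.val.map e).map (fun r : ℝ => (r : ℂ)) := by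
    intro e
    have := Polynomial.roots_multiset_prod_X_sub_C (Finset.univ.val.map fun i => (e i : ℂ))
    rw [Multiset.map_map] at this ⊢
    exact this
  have h3 := (hr hA.eigenvalues).symm.trans (h2.trans (hr d))
  have h4 := Multiset.map_injective Complex.ofReal_injective h3
  have h5 := congrArg (fun s => (s.map f).sum) h4
  simp only [Multiset.map_map] at h5
  exact h5

lemma traceNorm_eq_sum_abs_eigenvalues {A : Matrix ι ι ℂ} (hA : A.IsHermitian) :
    traceNorm A = ∑ i, |hA.eigenvalues i| := by
  have h : (A.conjTranspose * A).charpoly =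
      ∏ i, (Polynomial.X - Polynomial.C ((hA.eigenvalues i ^ 2 : ℝ) : ℂ)) := by
    have h1 : cfc (fun x : ℝ => x ^ 2) A = A.conjTranspose * A := by
      rw [cfc_pow_id (R := ℝ) A 2 hA.isSelfAdjoint, hA.eq, sq]
    rw [← h1]
    exact hA.charpoly_cfc_eq _
  rw [traceNorm, sum_comp_eigenvalues_eq_of_charpoly
    (Matrix.isHermitian_conjTranspose_mul_self A) h Real.sqrt]
  simp [Real.sqrt_sq_eq_abs]

/-- Duality: to bound the trace norm of a Hermitian matrix it suffices to test against unitaries. -/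
lemma traceNorm_le_of_forall_unitary {A : Matrix ι ι ℂ} (hA : A.IsHermitian) {c : ℝ}
    (h : ∀ S ∈ Matrix.unitaryGroup ι ℂ, ‖(A * S).trace‖ ≤ c) : traceNorm A ≤ c := by
  set V : Matrix ι ι ℂ := (hA.eigenvectorUnitary : Matrix ι ι ℂ) with hV
  have hVm : V ∈ Matrix.unitaryGroup ι ℂ := hA.eigenvectorUnitary.2
  -- The optimal test unitary is the sign of `A`. Zero eigenvalues get sign `1`, to keep it unitary.
  set s : ι → ℂ := fun i => if 0 ≤ hA.eigenvalues i then 1 else -1 with hs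
  have hsm : Matrix.diagonal s ∈ Matrix.unitaryGroup ι ℂ := by
    rw [Matrix.mem_unitaryGroup_iff, Matrix.star_eq_conjTranspose, Matrix.diagonal_conjTranspose,
      Matrix.diagonal_mul_diagonal, ← Matrix.diagonal_one]
    congr 1
    ext i
    by_cases hi : 0 ≤ hA.eigenvalues i <;> simp [hs, hi]
  have hSm : V * Matrix.diagonal s * star V ∈ Matrix.unitaryGroup ι ℂ :=
    mul_mem (mul_mem hVm hsm) (Unitary.star_mem hVm)
  have hspec := hA.spectral_theorem
  rw [Unitary.conjStarAlgAut_apply] at hspec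
  have hVV : star V * V = 1 := Matrix.mem_unitaryGroup_iff'.mp hVm
  have htr : (A * (V * Matrix.diagonal s * star V)).trace = ((traceNorm A : ℝ) : ℂ) := by
    have h1 : A * (V * Matrix.diagonal s * star V) =
        V * (Matrix.diagonal (RCLike.ofReal ∘ hA.eigenvalues) * Matrix.diagonal s) * star V := by
      conv_lhs => rw [hspec]
      calc _ = V * Matrix.diagonal (RCLike.ofReal ∘ hA.eigenvalues) * (star V * V) *
              Matrix.diagonal s * star V := by simp only [Matrix.mul_assoc]; rfl
        _ = _ := by rw [hVV]; simp only [Matrix.mul_assoc, Matrix.one_mul]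
    rw [h1, Matrix.trace_mul_comm, ← Matrix.mul_assoc, hVV, Matrix.one_mul,
      Matrix.diagonal_mul_diagonal, Matrix.trace_diagonal, traceNorm_eq_sum_abs_eigenvalues hA,
      Complex.ofReal_sum]
    refine Finset.sum_congr rfl fun i _ => ?_
    by_cases hi : 0 ≤ hA.eigenvalues i
    · simp [hs, hi, abs_of_nonneg hi]
    · simp [hs, hi, abs_of_neg (not_le.mp hi)]
  have := h _ hSm
  rw [htr, Complex.norm_real] at this
  exact (Real.le_norm_self _).trans this

/-- `B Bᴴ` and `Bᴴ B` are unitarily equivalent. -/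
lemma exists_unitary_mul_conjTranspose_self (B : Matrix ι ι ℂ) :
    ∃ V ∈ Matrix.unitaryGroup ι ℂ,
      B * B.conjTranspose = V * (B.conjTranspose * B) * V.conjTranspose := by
  have h1 := Matrix.isHermitian_mul_conjTranspose_self B
  have h2 := Matrix.isHermitian_conjTranspose_mul_self B
  have he := (Matrix.IsHermitian.eigenvalues_eq_eigenvalues_iff h1 h2).mpr
    (Matrix.charpoly_mul_comm _ _)
  have s1 := h1.spectral_theorem
  have s2 := h2.spectral_theorem
  rw [Unitary.conjStarAlgAut_apply] at s1 s2
  set V := (h1.eigenvectorUnitary : Matrix ι ι ℂ)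
  set W := (h2.eigenvectorUnitary : Matrix ι ι ℂ)
  have hW : star W * W = 1 := Matrix.mem_unitaryGroup_iff'.mp h2.eigenvectorUnitary.2
  -- The two products have the same characteristic polynomial, hence the same sorted eigenvalues;
  -- the witness carries one eigenbasis to the other.
  refine ⟨V * star W, mul_mem h1.eigenvectorUnitary.2 (Unitary.star_mem h2.eigenvectorUnitary.2), ?_⟩
  rw [he] at s1
  generalize h2.eigenvalues = e at s1 s2
  rw [s1, s2]
  rw [← Matrix.star_eq_conjTranspose, star_mul, star_star]
  calc _ = V * ((star W * W) * Matrix.diagonal (RCLike.ofReal ∘ e) * (star W * W)) *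
        star V := by rw [hW]; simp
    _ = _ := by simp only [Matrix.mul_assoc]

end TraceNorm

/-! ### Counting rearrangements -/

section Rearrangements

variable {ι : Type*} [DecidableEq ι]

/-- The number of permutations of positions that carry the tuple `u` to the tuple `v`. -/
def rearrangements {t : ℕ} (u v : Fin t → ι) : ℕ :=
  Fintype.card {σ : Equiv.Perm (Fin t) // u ∘ σ = v}

/-- The number of occurrences of `i` in the tuple `u`. -/
def occurrences {t : ℕ} (u : Fin t → ι) (i : ι) : ℕ := Fintype.card {k // u k = i}

lemma exists_perm_of_occurrences_eq {t : ℕ} {u v : Fin t → ι}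
    (h : ∀ i, occurrences u i = occurrences v i) :
    ∃ σ : Equiv.Perm (Fin t), u ∘ σ = v := by
  have e : ∀ i, {k // v k = i} ≃ {k // u k = i} := fun i => Fintype.equivOfCardEq (h i).symm
  exact ⟨Equiv.ofFiberEquiv e, funext fun k => Equiv.ofFiberEquiv_map e k⟩

lemma occurrences_eq_sum {t : ℕ} (u : Fin t → ι) (i : ι) :
    occurrences u i = ∑ k, if u k = i then 1 else 0 := by
  rw [occurrences, Fintype.card_subtype]
  simp

lemma rearrangements_comp_right {t : ℕ} (u v : Fin t → ι) (σ : Equiv.Perm (Fin t)) :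
    rearrangements u (v ∘ σ) = rearrangements u v := by
  refine Fintype.card_congr ((Equiv.mulRight σ⁻¹).subtypeEquiv fun τ => ?_)
  constructor
  · intro h
    ext k
    simpa using congrFun h (σ⁻¹ k)
  · intro h
    ext k
    simpa using congrFun h (σ k)

lemma rearrangements_self_pos {t : ℕ} (u : Fin t → ι) : 0 < rearrangements u u :=
  Fintype.card_pos_iff.mpr ⟨⟨1, rfl⟩⟩

lemma rearrangements_eq_sum {t : ℕ} (u v : Fin t → ι) :
    rearrangements u v = ∑ σ : Equiv.Perm (Fin t), if u ∘ σ = v then 1 else 0 := by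
  rw [rearrangements, Fintype.card_subtype]
  simp

lemma rearrangements_eq_self_of_perm {t : ℕ} {u v : Fin t → ι} {σ : Equiv.Perm (Fin t)}
    (h : u ∘ σ = v) : rearrangements u v = rearrangements u u := by
  rw [← h, rearrangements_comp_right]

/-- The exponent vector of `∏ X (u k)` records the occurrences in `u`, which determine `u` up to
rearrangement. -/
lemma monomial_tuple_injective {t : ℕ} {u v : Fin t → ι}
    (h : ∑ k, Finsupp.single (u k) 1 = ∑ k, Finsupp.single (v k) 1) :
    ∃ σ : Equiv.Perm (Fin t), u ∘ σ = v := by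
  refine exists_perm_of_occurrences_eq fun i => ?_
  have := DFunLike.congr_fun h i
  simpa [Finsupp.single_apply, occurrences_eq_sum] using this

variable [Fintype ι]

lemma rearrangements_self {t : ℕ} (u : Fin t → ι) :
    rearrangements u u = ∏ i, (occurrences u i).factorial :=
  DomMulAct.stabilizer_card u

lemma sum_occurrences {t : ℕ} (u : Fin t → ι) : ∑ i, occurrences u i = t := by
  simp only [occurrences_eq_sum]
  rw [Finset.sum_comm]
  simp

lemma rearrangements_snoc_self {t : ℕ} (u : Fin t → ι) (i : ι) :
    rearrangements (Fin.snoc u i : Fin (t + 1) → ι) (Fin.snoc u i) =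
      (occurrences u i + 1) * rearrangements u u := by
  have hocc : ∀ j, occurrences (Fin.snoc u i : Fin (t + 1) → ι) j =
      occurrences u j + if i = j then 1 else 0 := by
    intro j
    rw [occurrences_eq_sum, Fin.sum_univ_castSucc, occurrences_eq_sum]
    simp
  rw [rearrangements_self, rearrangements_self, ← Finset.mul_prod_erase _ _ (Finset.mem_univ i),
    ← Finset.mul_prod_erase _ (fun j => (occurrences u j).factorial) (Finset.mem_univ i),
    ← mul_assoc, hocc, if_pos rfl, Nat.factorial_succ]
  congr 1
  refine Finset.prod_congr rfl fun j hj => ?_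
  rw [hocc, if_neg (Finset.ne_of_mem_erase hj).symm, add_zero]

/-- Appending a letter `i` multiplies the stabilizer order by `occurrences u i + 1`, and these
factors sum over `i` to `card ι + t`. The result is `t!` times the dimension of the symmetric
subspace, which normalizes the moments. -/
lemma sum_rearrangements_self (t : ℕ) :
    ∑ u : Fin t → ι, rearrangements u u = (Fintype.card ι).ascFactorial t := by
  induction t with
  | zero => simp [rearrangements_self, occurrences]
  | succ t ih =>
    rw [← (Fin.snocEquiv fun _ : Fin (t + 1) => ι).sum_comp, Fintype.sum_prod_type, Finset.sum_comm]
    have h : ∀ u : Fin t → ι, ∑ i, rearrangements (Fin.snocEquiv (fun _ : Fin (t + 1) => ι) (i, u))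
        (Fin.snocEquiv (fun _ : Fin (t + 1) => ι) (i, u)) =
        (Fintype.card ι + t) * rearrangements u u := by
      intro u
      have : ∀ i, rearrangements (Fin.snocEquiv (fun _ : Fin (t + 1) => ι) (i, u))
          (Fin.snocEquiv (fun _ : Fin (t + 1) => ι) (i, u)) =
          (occurrences u i + 1) * rearrangements u u := fun i => rearrangements_snoc_self u i
      simp only [this]
      rw [← Finset.sum_mul, Finset.sum_add_distrib, sum_occurrences]
      simp [add_comm]
    simp only [h]
    rw [← Finset.mul_sum, ih, Nat.ascFactorial_succ]

/-- If a homogeneous polynomial, written as a symmetric sum over tuples, vanishes on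
nonnegative reals, then so do its coefficients. -/
lemma tuple_coeff_eq_zero {t : ℕ} (w : (Fin t → ι) → ℂ)
    (hw : ∀ u (σ : Equiv.Perm (Fin t)), w (u ∘ σ) = w u)
    (h : ∀ φ : ι → ℝ, ∑ u, w u * ∏ k, ((φ (u k) : ℂ) ^ 2) = 0) (u : Fin t → ι) : w u = 0 := by
  set P : MvPolynomial ι ℂ :=
    ∑ v : Fin t → ι, MvPolynomial.monomial (∑ k, Finsupp.single (v k) 1) (w v) with hP
  have hmon : ∀ (v : Fin t → ι) (x : ι → ℂ),
      MvPolynomial.eval x (MvPolynomial.monomial (∑ k, Finsupp.single (v k) 1) (w v)) =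
        w v * ∏ k, x (v k) := by
    intro v x
    have : MvPolynomial.monomial (∑ k, Finsupp.single (v k) 1) (w v) =
        MvPolynomial.C (w v) * ∏ k, MvPolynomial.X (v k) := by
      rw [← mul_one (w v), ← MvPolynomial.C_mul_monomial, mul_one, MvPolynomial.monomial_sum_one]
      rfl
    rw [this]
    simp
  -- The hypothesis controls the polynomial only at squares of reals; squares of naturals already
  -- form an infinite grid.
  have hinf : (Set.range fun r : ℕ => ((r : ℝ) : ℂ) ^ 2).Infinite := by
    refine Set.infinite_range_of_injective fun a b hab => ?_
    have h1 : a ^ 2 = b ^ 2 := by exact_mod_cast hab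
    exact Nat.pow_left_injective two_ne_zero h1
  have hP0 : P = 0 := by
    refine MvPolynomial.funext_set (fun _ => Set.range fun r : ℕ => ((r : ℝ) : ℂ) ^ 2)
      (fun _ => hinf) fun x hx => ?_
    choose r hr using fun i => hx i (Set.mem_univ i)
    rw [hP, map_sum, map_zero, ← h fun i => (r i : ℝ)]
    refine Finset.sum_congr rfl fun v _ => ?_
    rw [hmon]
    simp only [← hr]
  have hc := congrArg (MvPolynomial.coeff (∑ k, Finsupp.single (u k) 1)) hP0
  rw [hP, MvPolynomial.coeff_sum, MvPolynomial.coeff_zero] at hc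
  have hterm : ∀ v : Fin t → ι, MvPolynomial.coeff (∑ k, Finsupp.single (u k) 1)
      (MvPolynomial.monomial (∑ k, Finsupp.single (v k) 1) (w v)) =
      (if ∑ k, Finsupp.single (v k) 1 = ∑ k, Finsupp.single (u k) 1 then 1 else 0) * w u := by
    intro v
    rw [MvPolynomial.coeff_monomial]
    split_ifs with hv
    · obtain ⟨σ, hσ⟩ := monomial_tuple_injective hv.symm
      rw [← hσ, hw, one_mul]
    · rw [zero_mul]
  simp only [hterm] at hc
  rw [← Finset.sum_mul] at hc
  -- The coefficient is `w u` times the number of distinct rearrangements of `u`, which counts `u`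
  -- itself.
  refine (mul_eq_zero.mp hc).resolve_left ?_
  rw [Finset.sum_boole]
  exact_mod_cast Finset.card_ne_zero.mpr ⟨u, by simp⟩

/-- A matrix on tuples that is symmetric in the positions, supported on rearrangements and whose
quadratic form on real product vectors is a multiple of the norm is the normalized
symmetrizer. -/
lemma eq_rearrangements_of_quadratic_form {t : ℕ} (A : (Fin t → ι) → (Fin t → ι) → ℂ) (c : ℂ)
    (hl : ∀ u v (σ : Equiv.Perm (Fin t)), A (u ∘ σ) v = A u v)
    (hr : ∀ u v (σ : Equiv.Perm (Fin t)), A u (v ∘ σ) = A u v)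
    (hoff : ∀ u v, (∀ σ : Equiv.Perm (Fin t), u ∘ σ ≠ v) → A u v = 0)
    (hq : ∀ φ : ι → ℝ, ∑ u, ∑ v, (∏ k, (φ (u k) : ℂ)) * (∏ k, (φ (v k) : ℂ)) * A u v =
      c * (∑ i, (φ i : ℂ) ^ 2) ^ t)
    (htr : ∑ u, A u u = 1) (u v : Fin t → ι) :
    A u v = rearrangements u v / (Fintype.card ι).ascFactorial t := by
  have hperm : ∀ (φ : ι → ℝ) (u : Fin t → ι) (σ : Equiv.Perm (Fin t)),
      ∏ k, (φ ((u ∘ σ) k) : ℂ) = ∏ k, (φ (u k) : ℂ) := fun φ u σ =>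
    Equiv.prod_comp σ fun k => (φ (u k) : ℂ)
  -- On the support of `A` the two products of `φ` coincide, so the form is a polynomial in the
  -- squares `φ i ^ 2` with the row sums as coefficients; `(∑ φ i ^ 2) ^ t` expands with all
  -- coefficients one.
  have hrow : ∀ u, ∑ v, A u v = c := by
    intro u
    rw [← sub_eq_zero]
    refine tuple_coeff_eq_zero (fun u => ∑ v, A u v - c) (fun u σ => by simp only [hl])
      (fun φ => ?_) u
    have h1 : ∀ u : Fin t → ι, ∑ v, (∏ k, (φ (u k) : ℂ)) * (∏ k, (φ (v k) : ℂ)) * A u v =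
        (∑ v, A u v) * ∏ k, ((φ (u k) : ℂ) ^ 2) := by
      intro u
      rw [Finset.sum_mul]
      refine Finset.sum_congr rfl fun v _ => ?_
      by_cases hv : ∃ σ : Equiv.Perm (Fin t), u ∘ σ = v
      · obtain ⟨σ, rfl⟩ := hv
        rw [hperm, Finset.prod_pow]
        ring
      · rw [hoff u v (not_exists.mp hv)]
        simp
    have h2 := hq φ
    simp only [h1] at h2
    rw [Finset.sum_pow', Fintype.piFinset_univ, Finset.mul_sum] at h2
    simp only [sub_mul]
    rw [Finset.sum_sub_distrib, h2, sub_self]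
  -- Row `u` takes the single value `A u u` on all rearrangements of `u`, each reached by
  -- `rearrangements u u` permutations. Summing over permutations compares `A u u` with the row sum.
  have hdiag : ∀ u, (t.factorial : ℂ) * A u u = rearrangements u u * c := by
    intro u
    calc (t.factorial : ℂ) * A u u = ∑ σ : Equiv.Perm (Fin t), A u (u ∘ σ) := by
          simp [hr, Fintype.card_perm]
      _ = ∑ σ : Equiv.Perm (Fin t), ∑ v, (if u ∘ σ = v then 1 else 0) * A u v := by
          simp
      _ = ∑ v, (rearrangements u v : ℂ) * A u v := by
          rw [Finset.sum_comm]
          refine Finset.sum_congr rfl fun v _ => ?_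
          rw [← Finset.sum_mul, rearrangements_eq_sum]
          push_cast
          rfl
      _ = ∑ v, (rearrangements u u : ℂ) * A u v := by
          refine Finset.sum_congr rfl fun v _ => ?_
          by_cases hv : ∃ σ : Equiv.Perm (Fin t), u ∘ σ = v
          · obtain ⟨σ, hσ⟩ := hv
            rw [rearrangements_eq_self_of_perm hσ]
          · rw [hoff u v (not_exists.mp hv), mul_zero, mul_zero]
      _ = _ := by rw [← Finset.mul_sum, hrow]
  -- Summing `hdiag` over `u` and using the unit trace fixes `c`.
  have hc : ((Fintype.card ι).ascFactorial t : ℂ) * c = t.factorial := by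
    rw [← sum_rearrangements_self t]
    push_cast
    rw [Finset.sum_mul]
    simp only [← hdiag]
    rw [← Finset.mul_sum, htr, mul_one]
  have hf : (t.factorial : ℂ) ≠ 0 := by exact_mod_cast t.factorial_ne_zero
  have hD : ((Fintype.card ι).ascFactorial t : ℂ) ≠ 0 := left_ne_zero_of_mul (hc ▸ hf)
  by_cases hv : ∃ σ : Equiv.Perm (Fin t), u ∘ σ = v
  · obtain ⟨σ, hσ⟩ := hv
    rw [rearrangements_eq_self_of_perm hσ, ← hσ, hr, eq_div_iff hD]
    have := hdiag u
    apply mul_left_cancel₀ hf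
    calc _ = (t.factorial * A u u) * (Fintype.card ι).ascFactorial t := by ring
      _ = rearrangements u u * ((Fintype.card ι).ascFactorial t * c) := by rw [this]; ring
      _ = _ := by rw [hc]; ring
  · have : rearrangements u v = 0 := by
      rw [rearrangements, Fintype.card_eq_zero_iff]
      exact ⟨fun σ => hv ⟨σ.1, σ.2⟩⟩
    rw [hoff u v (not_exists.mp hv), this]
    simp

end Rearrangements

/-! ### Moments of a column of a Haar random unitary -/

section HaarMoments

variable {ι : Type*} [Fintype ι] [DecidableEq ι]

instance instIsHaarMeasureHaarUnitary : (haarUnitary ι).IsHaarMeasure :=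
  inferInstanceAs (Measure.haarMeasure ⊤).IsHaarMeasure

lemma integral_haarUnitary_mul_left (f : Matrix.unitaryGroup ι ℂ → ℂ)
    (V : Matrix.unitaryGroup ι ℂ) :
    ∫ U, f (V * U) ∂haarUnitary ι = ∫ U, f U ∂haarUnitary ι :=
  integral_mul_left_eq_self f V

/-- A right translate of Haar measure is again a left-invariant probability measure, so uniqueness
identifies the two. -/
lemma integral_haarUnitary_mul_right (f : Matrix.unitaryGroup ι ℂ → ℂ)
    (V : Matrix.unitaryGroup ι ℂ) :
    ∫ U, f (U * V) ∂haarUnitary ι = ∫ U, f U ∂haarUnitary ι := by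
  have hprob : IsProbabilityMeasure (Measure.map (· * V) (haarUnitary ι)) :=
    Measure.isProbabilityMeasure_map (continuous_mul_const V).measurable.aemeasurable
  have hm : Measure.map (· * V) (haarUnitary ι) = haarUnitary ι :=
    Measure.isHaarMeasure_eq_of_isProbabilityMeasure _ _
  conv_rhs => rw [← hm]
  exact ((Homeomorph.mulRight V).measurableEmbedding.integral_map f).symm

lemma integrable_haarUnitary {f : Matrix.unitaryGroup ι ℂ → ℂ} (hf : Continuous f) :
    Integrable f (haarUnitary ι) :=
  hf.integrable_of_hasCompactSupport (HasCompactSupport.of_compactSpace f)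

lemma continuous_unitaryGroup_entry (i j : ι) :
    Continuous fun U : Matrix.unitaryGroup ι ℂ => (U : Matrix ι ι ℂ) i j :=
  (continuous_apply_apply i j).comp continuous_subtype_val

/-- Mixed moments of the entries of one column of a Haar random unitary. -/
noncomputable def columnMoment {t : ℕ} (i₀ : ι) (u v : Fin t → ι) : ℂ :=
  ∫ U : Matrix.unitaryGroup ι ℂ, (∏ k, (U : Matrix ι ι ℂ) (u k) i₀) *
    (∏ k, star ((U : Matrix ι ι ℂ) (v k) i₀)) ∂haarUnitary ι

lemma integrable_columnMoment {t : ℕ} (i₀ : ι) (u v : Fin t → ι) :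
    Integrable (fun U : Matrix.unitaryGroup ι ℂ => (∏ k, (U : Matrix ι ι ℂ) (u k) i₀) *
      (∏ k, star ((U : Matrix ι ι ℂ) (v k) i₀))) (haarUnitary ι) := by
  refine integrable_haarUnitary (Continuous.mul ?_ ?_)
  · exact continuous_finsetProd _ fun k _ => continuous_unitaryGroup_entry _ _
  · exact continuous_finsetProd _ fun k _ => (continuous_unitaryGroup_entry _ _).star

/-- Every vector is a multiple of the chosen column of some unitary. -/
lemma exists_unitary_column (i₀ : ι) (φ : ι → ℝ) :
    ∃ V : Matrix.unitaryGroup ι ℂ, ∀ i,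
      (V : Matrix ι ι ℂ) i i₀ * (Real.sqrt (∑ i, φ i ^ 2) : ℂ) = φ i := by
  set r := Real.sqrt (∑ i, φ i ^ 2) with hr
  by_cases h0 : r = 0
  · refine ⟨1, fun i => ?_⟩
    have hs := (Real.sqrt_eq_zero (Finset.sum_nonneg fun i _ => sq_nonneg (φ i))).mp h0
    have := (Finset.sum_eq_zero_iff_of_nonneg fun i _ => sq_nonneg (φ i)).mp hs i
      (Finset.mem_univ i)
    simp [h0, pow_eq_zero_iff two_ne_zero |>.mp this]
  · set x : EuclideanSpace ℂ ι := WithLp.toLp 2 fun i => ((φ i / r : ℝ) : ℂ) with hx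
    have hx1 : ‖x‖ = 1 := by
      rw [EuclideanSpace.norm_eq, Real.sqrt_eq_one]
      have : ∀ i, ‖x i‖ ^ 2 = φ i ^ 2 / r ^ 2 := by
        intro i
        rw [hx, PiLp.toLp_apply, Complex.norm_real, Real.norm_eq_abs, sq_abs, div_pow]
      simp only [this]
      rw [← Finset.sum_div, hr, Real.sq_sqrt (Finset.sum_nonneg fun i _ => sq_nonneg (φ i)),
        div_self]
      intro h
      exact h0 (by rw [hr, h, Real.sqrt_zero])
    have hv : Orthonormal ℂ (({i₀} : Set ι).domRestrict fun _ => x) := by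
      constructor
      · intro _
        exact hx1
      · intro a b hab
        exact absurd (Subsingleton.elim a b) hab
    obtain ⟨b, hb⟩ := hv.exists_orthonormalBasis_extension_of_card_eq
      (by simp : Module.finrank ℂ (EuclideanSpace ℂ ι) = Fintype.card ι)
    refine ⟨⟨_, (EuclideanSpace.basisFun ι ℂ).toMatrix_orthonormalBasis_mem_unitary b⟩,
      fun i => ?_⟩
    have hbi : b i₀ = x := hb i₀ rfl
    have : (EuclideanSpace.basisFun ι ℂ).toBasis.toMatrix b i i₀ = x i := by
      simp [Module.Basis.toMatrix_apply, hbi]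
    change (EuclideanSpace.basisFun ι ℂ).toBasis.toMatrix b i i₀ * _ = _
    rw [this, hx, PiLp.toLp_apply, ← Complex.ofReal_mul, div_mul_cancel₀ _ h0]

/-- The form is the mean of `|⟨φ, U e⟩|^{2t}` with `e` the basis vector at `i₀`. Left invariance
rotates `φ` to a multiple of `e`, leaving a power of its norm times a constant. -/
lemma columnMoment_quadratic_form {t : ℕ} (i₀ : ι) (φ : ι → ℝ) :
    ∑ u : Fin t → ι, ∑ v : Fin t → ι,
      (∏ k, (φ (u k) : ℂ)) * (∏ k, (φ (v k) : ℂ)) * columnMoment i₀ u v =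
    columnMoment i₀ (fun _ : Fin t => i₀) (fun _ => i₀) * (∑ i, (φ i : ℂ) ^ 2) ^ t := by
  set f : Matrix.unitaryGroup ι ℂ → ℂ := fun U =>
    (∑ i, (φ i : ℂ) * (U : Matrix ι ι ℂ) i i₀) ^ t *
      (∑ i, (φ i : ℂ) * star ((U : Matrix ι ι ℂ) i i₀)) ^ t with hf
  have h1 : ∑ u : Fin t → ι, ∑ v : Fin t → ι,
      (∏ k, (φ (u k) : ℂ)) * (∏ k, (φ (v k) : ℂ)) * columnMoment i₀ u v =
      ∫ U, f U ∂haarUnitary ι := by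
    have hexp : ∀ U, f U = ∑ u : Fin t → ι, ∑ v : Fin t → ι,
        (∏ k, (φ (u k) : ℂ)) * (∏ k, (φ (v k) : ℂ)) *
        ((∏ k, (U : Matrix ι ι ℂ) (u k) i₀) * (∏ k, star ((U : Matrix ι ι ℂ) (v k) i₀))) := by
      intro U
      rw [hf]
      simp only
      rw [Finset.sum_pow', Finset.sum_pow', Fintype.piFinset_univ, Finset.sum_mul_sum]
      refine Finset.sum_congr rfl fun u _ => Finset.sum_congr rfl fun v _ => ?_
      rw [Finset.prod_mul_distrib, Finset.prod_mul_distrib]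
      ring
    simp only [hexp]
    rw [integral_finsetSum _ fun u _ => integrable_finsetSum _ fun v _ =>
      (integrable_columnMoment i₀ u v).const_mul _]
    refine Finset.sum_congr rfl fun u _ => ?_
    rw [integral_finsetSum _ fun v _ => (integrable_columnMoment i₀ u v).const_mul _]
    refine Finset.sum_congr rfl fun v _ => ?_
    rw [integral_const_mul]
    rfl
  obtain ⟨V, hV⟩ := exists_unitary_column i₀ φ
  set r := Real.sqrt (∑ i, φ i ^ 2) with hr
  have hVV : star (V : Matrix ι ι ℂ) * V = 1 := Matrix.mem_unitaryGroup_iff'.mp V.2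
  have hcol : ∀ U : Matrix.unitaryGroup ι ℂ,
      ∑ i, (φ i : ℂ) * ((V * U : Matrix.unitaryGroup ι ℂ) : Matrix ι ι ℂ) i i₀ =
        r * (U : Matrix ι ι ℂ) i₀ i₀ := by
    intro U
    -- Since `φ` is real, it is also `r` times the conjugate of the column of `V`, and the sum
    -- becomes an entry of `star V * V * U`.
    have hφ : ∀ i, (φ i : ℂ) = r * (star (V : Matrix ι ι ℂ)) i₀ i := by
      intro i
      rw [Matrix.star_apply, ← Complex.conj_ofReal (φ i), ← hV i, map_mul, Complex.conj_ofReal,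
        mul_comm]
      rfl
    simp only [hφ, mul_assoc]
    rw [← Finset.mul_sum]
    congr 1
    calc _ = (star (V : Matrix ι ι ℂ) * ((V : Matrix ι ι ℂ) * U)) i₀ i₀ := rfl
      _ = _ := by rw [← Matrix.mul_assoc, hVV, Matrix.one_mul]
  have hr2 : ((r : ℂ)) ^ 2 = ∑ i, (φ i : ℂ) ^ 2 := by
    rw [hr, ← Complex.ofReal_pow, Real.sq_sqrt (Finset.sum_nonneg fun i _ => sq_nonneg (φ i))]
    push_cast
    rfl
  rw [h1, ← integral_haarUnitary_mul_left f V, columnMoment, ← integral_mul_const]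
  congr 1
  ext U
  have hcol' : ∑ i, (φ i : ℂ) * star (((V * U : Matrix.unitaryGroup ι ℂ) : Matrix ι ι ℂ) i i₀) =
      r * star ((U : Matrix ι ι ℂ) i₀ i₀) := by
    have := congrArg star (hcol U)
    rw [star_sum] at this
    simpa [mul_comm] using this
  rw [hf]
  simp only
  rw [hcol, hcol', ← hr2]
  simp only [Finset.prod_const, Finset.card_univ, Fintype.card_fin]
  ring

/-- Some letter `i` occurs a different number of times in `u` and `v`. Multiplying row `i` of `U` by
a phase preserves Haar measure but rescales the integrand by a phase that can be made `-1`. -/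
lemma columnMoment_eq_zero {t : ℕ} (i₀ : ι) (u v : Fin t → ι)
    (h : ∀ σ : Equiv.Perm (Fin t), u ∘ σ ≠ v) : columnMoment i₀ u v = 0 := by
  obtain ⟨i, hi⟩ : ∃ i, occurrences u i ≠ occurrences v i := by
    by_contra! hc
    obtain ⟨σ, hσ⟩ := exists_perm_of_occurrences_eq hc
    exact h σ hσ
  set p := occurrences u i with hp
  set q := occurrences v i with hq
  have hpq : ((p : ℂ) - q) ≠ 0 := sub_ne_zero.mpr (by exact_mod_cast hi)
  -- This angle gives total phase `θ (p - q) = π`.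
  set θ : ℝ := Real.pi / ((p : ℝ) - q) with hθ
  set z : ℂ := Complex.exp (θ * Complex.I) with hz
  have hzz : z * star z = 1 := by
    rw [Complex.star_def, Complex.mul_conj, Complex.normSq_eq_norm_sq, hz,
      Complex.norm_exp_ofReal_mul_I]
    simp
  have hz1 : z ^ p * star z ^ q = -1 := by
    rw [Complex.star_def, hz, ← Complex.exp_conj, ← Complex.exp_nat_mul, ← Complex.exp_nat_mul,
      ← Complex.exp_add, ← Complex.exp_pi_mul_I]
    congr 1
    rw [map_mul, Complex.conj_ofReal, Complex.conj_I, hθ]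
    push_cast
    field_simp
    ring
  set d : ι → ℂ := fun j => if j = i then z else 1 with hd
  have hdm : Matrix.diagonal d ∈ Matrix.unitaryGroup ι ℂ := by
    rw [Matrix.mem_unitaryGroup_iff, Matrix.star_eq_conjTranspose, Matrix.diagonal_conjTranspose,
      Matrix.diagonal_mul_diagonal, ← Matrix.diagonal_one]
    congr 1
    ext j
    by_cases hj : j = i
    · simpa [hd, hj] using hzz
    · simp [hd, hj]
  have hprod : ∀ (w : Fin t → ι), ∏ k, d (w k) = z ^ occurrences w i := by
    intro w
    rw [occurrences_eq_sum, hd, ← Finset.prod_pow_eq_pow_sum]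
    refine Finset.prod_congr rfl fun k _ => ?_
    split_ifs <;> simp_all
  have hent : ∀ (U : Matrix.unitaryGroup ι ℂ) j,
      (((⟨_, hdm⟩ * U : Matrix.unitaryGroup ι ℂ) : Matrix ι ι ℂ)) j i₀ =
        d j * (U : Matrix ι ι ℂ) j i₀ := by
    intro U j
    change (Matrix.diagonal d * (U : Matrix ι ι ℂ)) j i₀ = _
    rw [Matrix.diagonal_mul]
  have key : columnMoment i₀ u v = -columnMoment i₀ u v := by
    conv_lhs => rw [columnMoment, ← integral_haarUnitary_mul_left _ ⟨_, hdm⟩]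
    rw [columnMoment, ← integral_neg]
    congr 1
    ext U
    simp only [hent, star_mul']
    rw [Finset.prod_mul_distrib, Finset.prod_mul_distrib, hprod]
    have : ∏ k, star (d (v k)) = star z ^ q := by
      rw [← star_prod, hprod, star_pow]
    rw [this]
    linear_combination (∏ k, (U : Matrix ι ι ℂ) (u k) i₀) *
      (∏ k, star ((U : Matrix ι ι ℂ) (v k) i₀)) * hz1
  exact CharZero.eq_neg_self_iff.mp key

/-- The moments of a Haar random unit vector. -/
theorem columnMoment_eq {t : ℕ} (i₀ : ι) (u v : Fin t → ι) :
    columnMoment i₀ u v = rearrangements u v / (Fintype.card ι).ascFactorial t := by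
  refine eq_rearrangements_of_quadratic_form (columnMoment i₀) _ (fun u v σ => ?_)
    (fun u v σ => ?_) (columnMoment_eq_zero i₀) (columnMoment_quadratic_form i₀) ?_ u v
  · simp only [columnMoment]
    congr 1
    ext U
    congr 1
    exact Equiv.prod_comp σ fun k => (U : Matrix ι ι ℂ) (u k) i₀
  · simp only [columnMoment]
    congr 1
    ext U
    congr 1
    exact Equiv.prod_comp σ fun k => star ((U : Matrix ι ι ℂ) (v k) i₀)
  · simp only [columnMoment]
    rw [← integral_finsetSum _ fun u _ => integrable_columnMoment i₀ u u]
    have : ∀ U : Matrix.unitaryGroup ι ℂ, ∑ u : Fin t → ι,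
        (∏ k, (U : Matrix ι ι ℂ) (u k) i₀) * (∏ k, star ((U : Matrix ι ι ℂ) (u k) i₀)) = 1 := by
      intro U
      simp only [← Finset.prod_mul_distrib]
      have hU := congrFun (congrFun (Matrix.mem_unitaryGroup_iff'.mp U.2) i₀) i₀
      rw [Matrix.mul_apply, Matrix.one_apply_eq] at hU
      have h2 := Finset.sum_pow' (n := t) (s := Finset.univ) (f := fun i =>
        (U : Matrix ι ι ℂ) i i₀ * star ((U : Matrix ι ι ℂ) i i₀))
      rw [Fintype.piFinset_univ] at h2
      rw [← h2, ← one_pow t, ← hU]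
      congr 1
      refine Finset.sum_congr rfl fun i _ => ?_
      rw [Matrix.star_apply, mul_comm]
    simp only [this]
    simp

end HaarMoments

/-! ### Reduction of the two ensembles to the traced-out register -/

section Reduction

variable {ι κ Λ : Type*} [Fintype ι] [DecidableEq ι] [Fintype κ] [DecidableEq κ] [Fintype Λ]
  [DecidableEq Λ]

/-- The matrix of the coordinate embedding of `ℂ^κ` into `ℂ^ι` given by `j : κ → ι`. -/
def embeddingMatrix (j : κ → ι) : Matrix ι κ ℂ := Matrix.of fun x a => if x = j a then 1 else 0

omit [Fintype κ] in
lemma embeddingMatrix_conjTranspose_mul_self {j : κ → ι} (hj : Function.Injective j) :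
    (embeddingMatrix j).conjTranspose * embeddingMatrix j = 1 := by
  ext a b
  simp [embeddingMatrix, Matrix.mul_apply, Matrix.one_apply, hj.eq_iff, eq_comm]

omit [Fintype ι] [DecidableEq κ] in
lemma embeddingMatrix_conj_apply (j : κ → ι) (C : Matrix κ κ ℂ) (x y : ι) :
    (embeddingMatrix j * C * (embeddingMatrix j).conjTranspose) x y =
      ∑ a, ∑ b, if x = j a ∧ y = j b then C a b else 0 := by
  rw [Matrix.mul_assoc, Matrix.mul_apply]
  refine Finset.sum_congr rfl fun a _ => ?_
  rw [Matrix.mul_apply, Finset.mul_sum]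
  refine Finset.sum_congr rfl fun b _ => ?_
  by_cases hx : x = j a <;> by_cases hy : y = j b <;> simp [embeddingMatrix, hx, hy]

/-- Only tuples with every letter in the range of `j` contribute, so the trace sees just the
corresponding block of `K`. -/
lemma trace_tensorPow_embedding_mul {j : κ → ι} (hj : Function.Injective j) (t : ℕ)
    (C : Matrix κ κ ℂ) (K : Matrix (Fin t → ι) (Fin t → ι) ℂ) :
    (tensorPow t (embeddingMatrix j * C * (embeddingMatrix j).conjTranspose) * K).trace =
      ∑ a : Fin t → κ, ∑ b : Fin t → κ, tensorPow t C a b * K (j ∘ b) (j ∘ a) := by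
  set E := embeddingMatrix j * C * (embeddingMatrix j).conjTranspose with hE
  have hin : ∀ a b, E (j a) (j b) = C a b := by
    intro a b
    rw [hE, embeddingMatrix_conj_apply]
    simp only [hj.eq_iff]
    rw [Finset.sum_eq_single a, Finset.sum_eq_single b] <;> simp_all [eq_comm]
  have hl : ∀ x y, x ∉ Set.range j → E x y = 0 := by
    intro x y hx
    rw [hE, embeddingMatrix_conj_apply]
    refine Finset.sum_eq_zero fun a _ => Finset.sum_eq_zero fun b _ => if_neg fun h => ?_
    exact hx ⟨a, h.1.symm⟩
  have hr : ∀ x y, y ∉ Set.range j → E x y = 0 := by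
    intro x y hy
    rw [hE, embeddingMatrix_conj_apply]
    refine Finset.sum_eq_zero fun a _ => Finset.sum_eq_zero fun b _ => if_neg fun h => ?_
    exact hy ⟨b, h.2.symm⟩
  have hout : ∀ x : Fin t → ι, x ∉ Set.range (fun a : Fin t → κ => j ∘ a) →
      ∃ k, x k ∉ Set.range j := by
    intro x hx
    by_contra! hc
    choose a ha using hc
    exact hx ⟨a, funext ha⟩
  rw [Matrix.trace]
  simp only [Matrix.diag_apply, Matrix.mul_apply]
  symm
  refine Fintype.sum_of_injective (fun a : Fin t → κ => j ∘ a) (hj.comp_left) _ _ ?_ ?_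
  · intro x hx
    obtain ⟨k, hk⟩ := hout x hx
    refine Finset.sum_eq_zero fun y _ => ?_
    rw [tensorPow_apply, Finset.prod_eq_zero (Finset.mem_univ k) (hl _ _ hk), zero_mul]
  · intro a
    refine Fintype.sum_of_injective (fun a : Fin t → κ => j ∘ a) (hj.comp_left) _ _ ?_ ?_
    · intro y hy
      obtain ⟨k, hk⟩ := hout y hy
      rw [tensorPow_apply, Finset.prod_eq_zero (Finset.mem_univ k) (hr _ _ hk), zero_mul]
    · intro b
      simp only [tensorPow_apply, Function.comp_apply, hin]

/-- A column of `V`, reshaped into a matrix along `e : Λ ≃ ι × κ`. -/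
def columnMatrix (e : Λ ≃ ι × κ) (q : Λ) (V : Matrix Λ Λ ℂ) : Matrix ι κ ℂ :=
  Matrix.of fun x a => V (e.symm (x, a)) q

omit [Fintype ι] [DecidableEq ι] [Fintype κ] [DecidableEq κ] in
lemma continuous_columnMatrix (e : Λ ≃ ι × κ) (q : Λ) :
    Continuous fun V : Matrix.unitaryGroup Λ ℂ => columnMatrix e q (V : Matrix Λ Λ ℂ) :=
  continuous_matrix fun _ _ => continuous_unitaryGroup_entry _ _

lemma continuous_tensorPow {α : Type*} (t : ℕ) : Continuous fun A : Matrix α α ℂ => tensorPow t A :=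
  continuous_matrix fun x y => by
    simp only [tensorPow_apply]
    exact continuous_finsetProd _ fun k _ => continuous_apply_apply (x k) (y k)

omit [DecidableEq ι] [DecidableEq κ] in
lemma trace_columnMatrix (e : Λ ≃ ι × κ) (q : Λ) (V : Matrix.unitaryGroup Λ ℂ) :
    (columnMatrix e q (V : Matrix Λ Λ ℂ) * (columnMatrix e q (V : Matrix Λ Λ ℂ)).conjTranspose).trace
      = 1 := by
  have hU := congrFun (congrFun (Matrix.mem_unitaryGroup_iff'.mp V.2) q) q
  rw [Matrix.mul_apply, Matrix.one_apply_eq, ← e.symm.sum_comp, Fintype.sum_prod_type] at hU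
  rw [← hU, Matrix.trace]
  refine Finset.sum_congr rfl fun x _ => ?_
  rw [Matrix.diag_apply, Matrix.mul_apply]
  refine Finset.sum_congr rfl fun a _ => ?_
  rw [Matrix.star_apply, mul_comm]
  rfl

/-- The operator `W ⊗ 1` in the coordinates given by `e : Λ ≃ ι × κ`. -/
def localUnitary (e : Λ ≃ ι × κ) (W : Matrix.unitaryGroup ι ℂ) : Matrix.unitaryGroup Λ ℂ :=
  ⟨((W : Matrix ι ι ℂ) ⊗ₖ (1 : Matrix κ κ ℂ)).submatrix e e, by
    rw [Matrix.mem_unitaryGroup_iff, Matrix.star_eq_conjTranspose, Matrix.conjTranspose_submatrix,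
      Matrix.submatrix_mul_equiv, Matrix.conjTranspose_kronecker, ← Matrix.mul_kronecker_mul,
      ← Matrix.star_eq_conjTranspose, Matrix.mem_unitaryGroup_iff.mp W.2]
    simp⟩

lemma columnMatrix_localUnitary_mul (e : Λ ≃ ι × κ) (q : Λ) (W : Matrix.unitaryGroup ι ℂ)
    (V : Matrix.unitaryGroup Λ ℂ) :
    columnMatrix e q ((localUnitary e W * V : Matrix.unitaryGroup Λ ℂ) : Matrix Λ Λ ℂ) =
      (W : Matrix ι ι ℂ) * columnMatrix e q (V : Matrix Λ Λ ℂ) := by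
  ext x a
  change (((W : Matrix ι ι ℂ) ⊗ₖ (1 : Matrix κ κ ℂ)).submatrix e e * (V : Matrix Λ Λ ℂ))
    (e.symm (x, a)) q = _
  rw [Matrix.mul_apply, Matrix.mul_apply, ← e.symm.sum_comp, Fintype.sum_prod_type]
  simp [Matrix.kroneckerMap_apply, Matrix.one_apply, columnMatrix]

/-- The `t`-copy moments of the reduced state on the traced-out register. -/
noncomputable def reducedMoment (e : Λ ≃ ι × κ) (q : Λ) (t : ℕ) (a b : Fin t → κ) : ℂ :=
  ∫ V : Matrix.unitaryGroup Λ ℂ, tensorPow t ((columnMatrix e q (V : Matrix Λ Λ ℂ)).conjTranspose *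
    columnMatrix e q (V : Matrix Λ Λ ℂ)) a b ∂haarUnitary Λ

lemma integral_trace_tensorPow_conj_swap (t : ℕ) (S : Matrix (Fin t → ι) (Fin t → ι) ℂ)
    {A : Matrix.unitaryGroup Λ ℂ → Matrix ι ι ℂ} (hA : Continuous A) :
    ∫ W : Matrix.unitaryGroup ι ℂ, ∫ V : Matrix.unitaryGroup Λ ℂ,
      (tensorPow t ((W : Matrix ι ι ℂ) * A V * (W : Matrix ι ι ℂ).conjTranspose) * S).trace
        ∂haarUnitary Λ ∂haarUnitary ι =
    ∫ V : Matrix.unitaryGroup Λ ℂ, ∫ W : Matrix.unitaryGroup ι ℂ,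
      (tensorPow t ((W : Matrix ι ι ℂ) * A V * (W : Matrix ι ι ℂ).conjTranspose) * S).trace
        ∂haarUnitary ι ∂haarUnitary Λ := by
  have hW : Continuous fun p : Matrix.unitaryGroup ι ℂ × Matrix.unitaryGroup Λ ℂ =>
    (p.1 : Matrix ι ι ℂ) := continuous_subtype_val.comp continuous_fst
  have hc := (((continuous_tensorPow t).comp ((hW.matrix_mul (hA.comp continuous_snd)).matrix_mul
    hW.matrix_conjTranspose)).matrix_mul (continuous_const (y := S))).matrix_trace
  exact integral_integral_swap_of_hasCompactSupport hc (HasCompactSupport.of_compactSpace _)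

lemma continuous_conjTensorPow (t : ℕ) (S : Matrix (Fin t → ι) (Fin t → ι) ℂ) :
    Continuous fun W : Matrix.unitaryGroup ι ℂ => conjTensorPow t (W : Matrix ι ι ℂ) S := by
  have h := (continuous_tensorPow (α := ι) t).comp
    (continuous_subtype_val (p := fun U => U ∈ Matrix.unitaryGroup ι ℂ))
  exact (h.matrix_conjTranspose.matrix_mul continuous_const).matrix_mul h

/-- The unitary twirl of `G Gᴴ` depends only on its spectrum. -/
lemma integral_trace_conj_mul_conjTranspose {j : κ → ι} (hj : Function.Injective j) (t : ℕ)
    (S : Matrix (Fin t → ι) (Fin t → ι) ℂ) (G : Matrix ι κ ℂ) :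
    ∫ W : Matrix.unitaryGroup ι ℂ, (tensorPow t ((W : Matrix ι ι ℂ) *
        (G * G.conjTranspose) * (W : Matrix ι ι ℂ).conjTranspose) * S).trace ∂haarUnitary ι =
      ∫ W : Matrix.unitaryGroup ι ℂ, (tensorPow t ((W : Matrix ι ι ℂ) *
        (embeddingMatrix j * (G.conjTranspose * G) * (embeddingMatrix j).conjTranspose) *
          (W : Matrix ι ι ℂ).conjTranspose) * S).trace ∂haarUnitary ι := by
  set P := embeddingMatrix j
  -- Padding `G` to the square matrix `G * Pᴴ` leaves `G * Gᴴ` unchanged and turns `Gᴴ * G` into its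
  -- embedded copy. The conjugating unitary `R` is then absorbed by right invariance.
  obtain ⟨R, hR, hRR⟩ := exists_unitary_mul_conjTranspose_self (G * P.conjTranspose)
  have h1 : G * P.conjTranspose * (G * P.conjTranspose).conjTranspose = G * G.conjTranspose := by
    rw [Matrix.conjTranspose_mul, Matrix.conjTranspose_conjTranspose, Matrix.mul_assoc,
      ← Matrix.mul_assoc _ P, embeddingMatrix_conjTranspose_mul_self hj, Matrix.one_mul]
  have h2 : (G * P.conjTranspose).conjTranspose * (G * P.conjTranspose) =
      P * (G.conjTranspose * G) * P.conjTranspose := by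
    rw [Matrix.conjTranspose_mul, Matrix.conjTranspose_conjTranspose]
    simp only [Matrix.mul_assoc]
  rw [h1, h2] at hRR
  generalize P * (G.conjTranspose * G) * P.conjTranspose = B at hRR ⊢
  rw [hRR, ← integral_haarUnitary_mul_right (fun W : Matrix.unitaryGroup ι ℂ =>
    (tensorPow t ((W : Matrix ι ι ℂ) * B * (W : Matrix ι ι ℂ).conjTranspose) * S).trace) ⟨R, hR⟩]
  refine integral_congr_ae (Filter.Eventually.of_forall fun W => ?_)
  have : ((W * ⟨R, hR⟩ : Matrix.unitaryGroup ι ℂ) : Matrix ι ι ℂ) = (W : Matrix ι ι ℂ) * R := rfl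
  simp only [this, Matrix.conjTranspose_mul, Matrix.mul_assoc]

/-- The law of a reduced random pure state is unitarily invariant. -/
lemma integral_trace_columnMatrix_conj (e : Λ ≃ ι × κ) (q : Λ) (t : ℕ)
    (S : Matrix (Fin t → ι) (Fin t → ι) ℂ) (W : Matrix.unitaryGroup ι ℂ) :
    ∫ V : Matrix.unitaryGroup Λ ℂ, (tensorPow t ((W : Matrix ι ι ℂ) *
      (columnMatrix e q (V : Matrix Λ Λ ℂ) * (columnMatrix e q (V : Matrix Λ Λ ℂ)).conjTranspose) *
        (W : Matrix ι ι ℂ).conjTranspose) * S).trace ∂haarUnitary Λ =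
    ∫ V : Matrix.unitaryGroup Λ ℂ, (tensorPow t (columnMatrix e q (V : Matrix Λ Λ ℂ) *
      (columnMatrix e q (V : Matrix Λ Λ ℂ)).conjTranspose) * S).trace ∂haarUnitary Λ := by
  -- Conjugation by `W` on the kept register comes from `W ⊗ 1` acting on the global vector, which
  -- left invariance absorbs.
  rw [← integral_haarUnitary_mul_left (fun V : Matrix.unitaryGroup Λ ℂ =>
    (tensorPow t (columnMatrix e q (V : Matrix Λ Λ ℂ) *
      (columnMatrix e q (V : Matrix Λ Λ ℂ)).conjTranspose) * S).trace) (localUnitary e W)]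
  refine integral_congr_ae (Filter.Eventually.of_forall fun V => ?_)
  simp only [columnMatrix_localUnitary_mul, Matrix.conjTranspose_mul, Matrix.mul_assoc]

omit [DecidableEq ι] [Fintype κ] [DecidableEq κ] in
lemma continuous_columnMatrix_conjTranspose_mul_self (e : Λ ≃ ι × κ) (q : Λ) :
    Continuous fun V : Matrix.unitaryGroup Λ ℂ =>
      (columnMatrix e q (V : Matrix Λ Λ ℂ)).conjTranspose * columnMatrix e q (V : Matrix Λ Λ ℂ) :=
  (continuous_columnMatrix e q).matrix_conjTranspose.matrix_mul (continuous_columnMatrix e q)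

omit [DecidableEq ι] [DecidableEq κ] in
lemma integral_sum_reduced (e : Λ ≃ ι × κ) (q : Λ) (t : ℕ) (K : (Fin t → κ) → (Fin t → κ) → ℂ) :
    ∫ V : Matrix.unitaryGroup Λ ℂ, ∑ a : Fin t → κ, ∑ b : Fin t → κ,
      tensorPow t ((columnMatrix e q (V : Matrix Λ Λ ℂ)).conjTranspose *
        columnMatrix e q (V : Matrix Λ Λ ℂ)) a b * K a b ∂haarUnitary Λ =
    ∑ a : Fin t → κ, ∑ b : Fin t → κ, reducedMoment e q t a b * K a b := by
  have hi : ∀ a b : Fin t → κ, Integrable (fun V : Matrix.unitaryGroup Λ ℂ =>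
      tensorPow t ((columnMatrix e q (V : Matrix Λ Λ ℂ)).conjTranspose *
        columnMatrix e q (V : Matrix Λ Λ ℂ)) a b * K a b) (haarUnitary Λ) := fun a b =>
    (integrable_haarUnitary (((continuous_tensorPow t).comp
      (continuous_columnMatrix_conjTranspose_mul_self e q)).matrix_elem a b)).mul_const _
  rw [integral_finsetSum _ fun a _ => integrable_finsetSum _ fun b _ => hi a b]
  refine Finset.sum_congr rfl fun a _ => ?_
  rw [integral_finsetSum _ fun b _ => hi a b]
  exact Finset.sum_congr rfl fun b _ => integral_mul_const _ _

/-- The passage to the small register: insert a twirl, exchange the integrals, replace `G Gᴴ` by the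
embedded `Gᴴ G`, and exchange back, so that the inner average is `reducedMoment`. -/
lemma integral_trace_columnMatrix (e : Λ ≃ ι × κ) (q : Λ) {j : κ → ι} (hj : Function.Injective j)
    (t : ℕ) (S : Matrix (Fin t → ι) (Fin t → ι) ℂ) :
    ∫ V : Matrix.unitaryGroup Λ ℂ, (tensorPow t (columnMatrix e q (V : Matrix Λ Λ ℂ) *
      (columnMatrix e q (V : Matrix Λ Λ ℂ)).conjTranspose) * S).trace ∂haarUnitary Λ =
    ∫ W : Matrix.unitaryGroup ι ℂ, ∑ a : Fin t → κ, ∑ b : Fin t → κ,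
      reducedMoment e q t a b * conjTensorPow t (W : Matrix ι ι ℂ) S (j ∘ b) (j ∘ a)
      ∂haarUnitary ι := by
  have hGc := continuous_columnMatrix e q
  have hs1 := integral_trace_tensorPow_conj_swap t S (hGc.matrix_mul hGc.matrix_conjTranspose)
  have hs2 := integral_trace_tensorPow_conj_swap t S
    (((continuous_const (y := embeddingMatrix j)).matrix_mul
      (continuous_columnMatrix_conjTranspose_mul_self e q)).matrix_mul
        (continuous_const (y := (embeddingMatrix j).conjTranspose)))
  -- The inner integral no longer depends on `W`, so the outer average is trivial.
  simp only [integral_trace_columnMatrix_conj] at hs1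
  rw [integral_const, probReal_univ, one_smul] at hs1
  rw [hs1]
  simp only [integral_trace_conj_mul_conjTranspose hj]
  rw [← hs2]
  simp only [trace_tensorPow_conj_mul, trace_tensorPow_embedding_mul hj]
  refine integral_congr_ae (Filter.Eventually.of_forall fun W => ?_)
  exact integral_sum_reduced e q t _

/-- Comparison of a reduced random pure state with the random embedding of a fixed operator, when
both are tested against a unitary. -/
lemma norm_integral_trace_sub_le (e : Λ ≃ ι × κ) (q : Λ) {j : κ → ι} (hj : Function.Injective j)
    (t : ℕ) {S : Matrix (Fin t → ι) (Fin t → ι) ℂ} (hS : S ∈ Matrix.unitaryGroup (Fin t → ι) ℂ)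
    (C : Matrix κ κ ℂ) :
    ‖∫ V : Matrix.unitaryGroup Λ ℂ, (tensorPow t (columnMatrix e q (V : Matrix Λ Λ ℂ) *
      (columnMatrix e q (V : Matrix Λ Λ ℂ)).conjTranspose) * S).trace ∂haarUnitary Λ -
    ∫ W : Matrix.unitaryGroup ι ℂ, (tensorPow t ((W : Matrix ι ι ℂ) *
      (embeddingMatrix j * C * (embeddingMatrix j).conjTranspose) *
        (W : Matrix ι ι ℂ).conjTranspose) * S).trace ∂haarUnitary ι‖ ≤
    ∑ a : Fin t → κ, ∑ b : Fin t → κ, ‖reducedMoment e q t a b - tensorPow t C a b‖ := by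
  have hint : ∀ F : (Fin t → κ) → (Fin t → κ) → ℂ, Integrable (fun W : Matrix.unitaryGroup ι ℂ =>
      ∑ a : Fin t → κ, ∑ b : Fin t → κ,
        F a b * conjTensorPow t (W : Matrix ι ι ℂ) S (j ∘ b) (j ∘ a)) (haarUnitary ι) := fun F =>
    integrable_haarUnitary (continuous_finsetSum _ fun a _ => continuous_finsetSum _ fun b _ =>
      continuous_const.mul ((continuous_conjTensorPow t S).matrix_elem _ _))
  rw [integral_trace_columnMatrix e q hj]
  simp only [trace_tensorPow_conj_mul, trace_tensorPow_embedding_mul hj]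
  rw [← integral_sub (hint (reducedMoment e q t)) (hint fun a b => tensorPow t C a b)]
  refine (norm_integral_le_of_norm_le_const (C := ∑ a : Fin t → κ, ∑ b : Fin t → κ,
    ‖reducedMoment e q t a b - tensorPow t C a b‖) (Filter.Eventually.of_forall fun W => ?_)).trans
    (by rw [probReal_univ, mul_one])
  simp only [← Finset.sum_sub_distrib, ← sub_mul]
  refine (norm_sum_le _ _).trans (Finset.sum_le_sum fun a _ => ?_)
  refine (norm_sum_le _ _).trans (Finset.sum_le_sum fun b _ => ?_)
  rw [norm_mul]
  exact mul_le_of_le_one_right (norm_nonneg _)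
    (entry_norm_bound_of_unitary (conjTensorPow_mem_unitaryGroup t W.2 hS) _ _)

end Reduction

/-! ### Estimates for the moments of the traced-out register -/

section ReducedMoments

variable {ι κ Λ : Type*} [Fintype ι] [DecidableEq ι] [Fintype κ] [DecidableEq κ] [Fintype Λ]
  [DecidableEq Λ]

/-- The tuple in `Λ` with components `z` and `a` along `e : Λ ≃ ι × κ`. -/
def pairTuple (e : Λ ≃ ι × κ) {t : ℕ} (z : Fin t → ι) (a : Fin t → κ) : Fin t → Λ :=
  fun k => e.symm (z k, a k)

/-- The number of coincidences that contribute to the reduced moment. -/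
def pairRearrangements (e : Λ ≃ ι × κ) {t : ℕ} (a b : Fin t → κ) : ℕ :=
  ∑ z : Fin t → ι, rearrangements (pairTuple e z b) (pairTuple e z a)

-- Expanding the product `Gᴴ G` at each of the `t` positions gives a sum over intermediate tuples
-- `z` of moments of one Haar column.
omit [DecidableEq ι] [Fintype κ] [DecidableEq κ] in
lemma reducedMoment_eq (e : Λ ≃ ι × κ) (q : Λ) {t : ℕ} (a b : Fin t → κ) :
    reducedMoment e q t a b =
      (pairRearrangements e a b : ℂ) / (Fintype.card Λ).ascFactorial t := by
  have h : ∀ V : Matrix.unitaryGroup Λ ℂ,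
      tensorPow t ((columnMatrix e q (V : Matrix Λ Λ ℂ)).conjTranspose *
        columnMatrix e q (V : Matrix Λ Λ ℂ)) a b =
      ∑ z : Fin t → ι, (∏ k, (V : Matrix Λ Λ ℂ) (pairTuple e z b k) q) *
        ∏ k, star ((V : Matrix Λ Λ ℂ) (pairTuple e z a k) q) := by
    intro V
    simp only [tensorPow_apply, Matrix.mul_apply]
    rw [Finset.prod_univ_sum, Fintype.piFinset_univ]
    refine Finset.sum_congr rfl fun z _ => ?_
    rw [← Finset.prod_mul_distrib]
    refine Finset.prod_congr rfl fun k _ => ?_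
    rw [mul_comm]
    rfl
  simp only [reducedMoment, h]
  rw [integral_finsetSum _ fun z _ => integrable_columnMoment q _ _, pairRearrangements]
  push_cast
  rw [Finset.sum_div]
  exact Finset.sum_congr rfl fun z _ => columnMoment_eq q _ _

-- The identity permutation contributes for every `z`.
omit [DecidableEq ι] [Fintype κ] [DecidableEq κ] [Fintype Λ] in
lemma card_pow_le_pairRearrangements_self (e : Λ ≃ ι × κ) {t : ℕ} (a : Fin t → κ) :
    Fintype.card ι ^ t ≤ pairRearrangements e a a := by
  have h : ∑ _z : Fin t → ι, 1 ≤ pairRearrangements e a a :=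
    Finset.sum_le_sum fun z _ => rearrangements_self_pos _
  simpa using h

-- A permutation must fix `z` and carry `b` to `a`. Given `b` and `σ` the tuple `a` is determined,
-- so summing over `a` leaves the stabilizer of `z`, with `b` free.
omit [Fintype Λ] in
lemma sum_pairRearrangements (e : Λ ≃ ι × κ) (t : ℕ) :
    ∑ a : Fin t → κ, ∑ b : Fin t → κ, pairRearrangements e a b =
      Fintype.card κ ^ t * (Fintype.card ι).ascFactorial t := by
  have hiff : ∀ (z : Fin t → ι) (a b : Fin t → κ) (σ : Equiv.Perm (Fin t)),
      pairTuple e z b ∘ σ = pairTuple e z a ↔ z ∘ σ = z ∧ b ∘ σ = a := by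
    intro z a b σ
    simp only [funext_iff, Function.comp_apply, pairTuple, e.symm.injective.eq_iff,
      Prod.mk.injEq, forall_and]
  have hb : ∀ (b : Fin t → κ) (z : Fin t → ι),
      ∑ a : Fin t → κ, rearrangements (pairTuple e z b) (pairTuple e z a) =
        rearrangements z z := by
    intro b z
    simp only [rearrangements_eq_sum, hiff, ite_and]
    rw [Finset.sum_comm]
    refine Finset.sum_congr rfl fun σ _ => ?_
    split_ifs <;> simp
  rw [Finset.sum_comm]
  simp only [pairRearrangements]
  calc _ = ∑ b : Fin t → κ, ∑ z : Fin t → ι, ∑ a : Fin t → κ,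
        rearrangements (pairTuple e z b) (pairTuple e z a) :=
        Finset.sum_congr rfl fun b _ => Finset.sum_comm
    _ = _ := by
        simp only [hb, sum_rearrangements_self]
        simp

omit [DecidableEq ι] [DecidableEq κ] [DecidableEq Λ] in
lemma card_eq_mul (e : Λ ≃ ι × κ) : Fintype.card Λ = Fintype.card ι * Fintype.card κ := by
  rw [Fintype.card_congr e, Fintype.card_prod]

lemma pow_le_ascFactorial (n t : ℕ) : n ^ t ≤ n.ascFactorial t := by
  induction t with
  | zero => simp
  | succ t ih =>
    rw [Nat.ascFactorial_succ, pow_succ, mul_comm]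
    exact Nat.mul_le_mul (Nat.le_add_right _ _) ih

/-- Factor by factor, `n * m + k ≤ m * (n + k)`. -/
lemma ascFactorial_mul_le (n m t : ℕ) (hm : 0 < m) :
    (n * m).ascFactorial t ≤ m ^ t * n.ascFactorial t := by
  induction t with
  | zero => simp
  | succ t ih =>
    rw [Nat.ascFactorial_succ, Nat.ascFactorial_succ, pow_succ]
    calc (n * m + t) * (n * m).ascFactorial t ≤ (n * m + t * m) * (m ^ t * n.ascFactorial t) :=
          Nat.mul_le_mul (Nat.add_le_add_left (Nat.le_mul_of_pos_right t hm) _) ih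
      _ = _ := by ring

/-- Each factor satisfies `n + k ≤ n * exp (k / n)`; the sum of the `k < t` is bounded generously by
`t ^ 2`. -/
lemma ascFactorial_le_pow_mul_exp (n t : ℕ) (hn : 0 < n) :
    (n.ascFactorial t : ℝ) ≤ n ^ t * Real.exp ((t : ℝ) ^ 2 / n) := by
  have hn' : (0 : ℝ) < n := by exact_mod_cast hn
  induction t with
  | zero => simp
  | succ t ih =>
    rw [Nat.ascFactorial_succ]
    push_cast
    have h1 : (n : ℝ) + t = n * (t / n + 1) := by field_simp; ring
    have h2 : (t : ℝ) / n + 1 ≤ Real.exp (t / n) := Real.add_one_le_exp _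
    calc ((n : ℝ) + t) * n.ascFactorial t
        ≤ (n * Real.exp (t / n)) * (n ^ t * Real.exp ((t : ℝ) ^ 2 / n)) := by
          rw [h1]
          gcongr
      _ = n ^ (t + 1) * Real.exp (((t : ℝ) ^ 2 + t) / n) := by
          rw [add_div, Real.exp_add]
          ring
      _ ≤ n ^ (t + 1) * Real.exp (((t : ℝ) + 1) ^ 2 / n) := by
          have : (0 : ℝ) ≤ t := Nat.cast_nonneg t
          gcongr
          nlinarith

/-- The reduced moments are close to those of the maximally mixed state. -/
lemma sum_norm_reducedMoment_sub_le [Nonempty ι] [Nonempty κ] (e : Λ ≃ ι × κ) (q : Λ) (t : ℕ)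
    (ht : t ^ 2 ≤ Fintype.card ι) :
    ∑ a : Fin t → κ, ∑ b : Fin t → κ,
      ‖reducedMoment e q t a b - tensorPow t (((Fintype.card κ : ℂ))⁻¹ • (1 : Matrix κ κ ℂ)) a b‖ ≤
      6 * ((t : ℝ) ^ 2 / Fintype.card ι) := by
  set N := Fintype.card ι with hN
  set M := Fintype.card κ with hM
  have hNpos : 0 < N := Fintype.card_pos
  have hMpos : 0 < M := Fintype.card_pos
  have hN' : (0 : ℝ) < N := by exact_mod_cast hNpos
  have hM' : (0 : ℝ) < M := by exact_mod_cast hMpos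
  set D : ℝ := ((N * M).ascFactorial t : ℝ) with hD
  have hDlow : (N : ℝ) ^ t * (M : ℝ) ^ t ≤ D := by
    rw [← mul_pow, hD]
    exact_mod_cast pow_le_ascFactorial (N * M) t
  have hDup : D ≤ (M : ℝ) ^ t * (N.ascFactorial t : ℝ) := by
    rw [hD]
    exact_mod_cast ascFactorial_mul_le N M t hMpos
  have hDpos : 0 < D := lt_of_lt_of_le (by positivity) hDlow
  have htp : ∀ a b : Fin t → κ, tensorPow t (((M : ℂ))⁻¹ • (1 : Matrix κ κ ℂ)) a b =
      ((if a = b then ((M : ℝ) ^ t)⁻¹ else 0 : ℝ) : ℂ) := by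
    intro a b
    rw [Matrix.smul_one_eq_diagonal, tensorPow_diagonal, Matrix.diagonal_apply]
    split_ifs <;> simp
  have hqle : (N : ℝ) ^ t / D ≤ ((M : ℝ) ^ t)⁻¹ := by
    rw [div_le_iff₀ hDpos, inv_mul_eq_div, le_div_iff₀ (by positivity)]
    exact hDlow
  -- On the diagonal this is `|x - y| ≤ x + y - 2 * q` for a common lower bound `q` of `x` and `y`,
  -- here `q = N ^ t / D`. It makes the sum exactly computable.
  have hterm : ∀ a b : Fin t → κ,
      ‖reducedMoment e q t a b - tensorPow t (((M : ℂ))⁻¹ • (1 : Matrix κ κ ℂ)) a b‖ ≤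
      (pairRearrangements e a b : ℝ) / D +
        (if a = b then ((M : ℝ) ^ t)⁻¹ - 2 * ((N : ℝ) ^ t / D) else 0) := by
    intro a b
    have : reducedMoment e q t a b = (((pairRearrangements e a b : ℝ) / D : ℝ) : ℂ) := by
      rw [reducedMoment_eq, card_eq_mul e, hD]
      push_cast
      rfl
    rw [this, htp, ← Complex.ofReal_sub, Complex.norm_real, Real.norm_eq_abs]
    have h0 : 0 ≤ (pairRearrangements e a b : ℝ) / D := by positivity
    split_ifs with hab
    · have h1 : (N : ℝ) ^ t / D ≤ (pairRearrangements e a b : ℝ) / D := by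
        rw [← hab]
        gcongr
        exact_mod_cast card_pow_le_pairRearrangements_self e a
      rw [abs_le]
      constructor <;> linarith
    · rw [sub_zero, add_zero, abs_of_nonneg h0]
  -- All errors are measured by `p`, the product of the `1 + k / N` for `k < t`.
  set p : ℝ := (N.ascFactorial t : ℝ) / N ^ t with hp
  have hp1 : 1 ≤ p := by
    rw [hp, le_div_iff₀ (by positivity), one_mul]
    exact_mod_cast pow_le_ascFactorial N t
  have hpN : (N.ascFactorial t : ℝ) = p * N ^ t := by
    rw [hp, div_mul_cancel₀ _ (by positivity)]
  have hpexp : p - 1 ≤ 2 * ((t : ℝ) ^ 2 / N) := by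
    have h1 : p ≤ Real.exp ((t : ℝ) ^ 2 / N) := by
      rw [hp, div_le_iff₀ (by positivity), mul_comm]
      exact ascFactorial_le_pow_mul_exp N t hNpos
    have h2 : |(t : ℝ) ^ 2 / N| ≤ 1 := by
      rw [abs_of_nonneg (by positivity), div_le_one hN']
      exact_mod_cast ht
    have h3 := Real.abs_exp_sub_one_le h2
    rw [abs_of_nonneg (a := (t : ℝ) ^ 2 / N) (by positivity)] at h3
    linarith [le_abs_self (Real.exp ((t : ℝ) ^ 2 / N) - 1)]
  have hsum : ∑ a : Fin t → κ, ∑ b : Fin t → κ, ((pairRearrangements e a b : ℝ) / D +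
        (if a = b then ((M : ℝ) ^ t)⁻¹ - 2 * ((N : ℝ) ^ t / D) else 0)) =
      (M : ℝ) ^ t * (p * N ^ t) / D + (1 - 2 * ((N : ℝ) ^ t * (M : ℝ) ^ t / D)) := by
    have h1 := sum_pairRearrangements e t
    have h2 : ∑ a : Fin t → κ, ∑ b : Fin t → κ, (pairRearrangements e a b : ℝ) =
        (M : ℝ) ^ t * (p * N ^ t) := by
      rw [← hpN]
      exact_mod_cast h1
    simp only [Finset.sum_add_distrib, ← Finset.sum_div]
    rw [h2]
    congr 1
    simp only [Finset.sum_ite_eq, Finset.mem_univ, if_true, Finset.sum_const, Finset.card_univ,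
      Fintype.card_pi_const, nsmul_eq_mul]
    rw [← hM]
    push_cast
    field_simp
  have hA : (M : ℝ) ^ t * (p * N ^ t) / D ≤ p := by
    rw [div_le_iff₀ hDpos]
    nlinarith
  -- The upper bound on `D` gives `1 / p`, and `1 / p ≥ 2 - p` keeps the estimate linear in `p`.
  have hB : 2 - p ≤ (N : ℝ) ^ t * (M : ℝ) ^ t / D := by
    rw [hpN] at hDup
    have h1 : (1 : ℝ) / p ≤ (N : ℝ) ^ t * (M : ℝ) ^ t / D := by
      rw [div_le_div_iff₀ (by linarith) hDpos]
      linarith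
    have h2 : 2 - p ≤ 1 / p := by
      rw [le_div_iff₀ (by linarith)]
      nlinarith [sq_nonneg (p - 1)]
    linarith
  calc _ ≤ _ := Finset.sum_le_sum fun a _ => Finset.sum_le_sum fun b _ => hterm a b
    _ = _ := hsum
    -- The total is at most `p + 1 - 2 * (2 - p) = 3 * (p - 1)`, and `p - 1 ≤ 2 * (t ^ 2 / N)` gives
    -- the constant 6.
    _ ≤ _ := by linarith

end ReducedMoments

/-! ### Moment operators of the two ensembles -/

section Ensembles

variable {Λ : Type*} [Fintype Λ] [DecidableEq Λ]

lemma momentOp_map_apply {n : ℕ} (t : ℕ) {F : Matrix.unitaryGroup Λ ℂ → QubitOp n}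
    (hF : Continuous F) (x y : Fin t → Qubits n) :
    momentOp t ((haarUnitary Λ).map F) x y = ∫ U, tensorPow t (F U) x y ∂haarUnitary Λ := by
  have hc : Continuous fun ρ : QubitOp n => tensorPow t ρ x y :=
    (continuous_tensorPow t).matrix_elem x y
  exact integral_map hF.measurable.aemeasurable hc.aestronglyMeasurable

lemma isHermitian_momentOp_map {n : ℕ} (t : ℕ) {F : Matrix.unitaryGroup Λ ℂ → QubitOp n}
    (hF : Continuous F) (hH : ∀ U, (F U).IsHermitian) :
    (momentOp t ((haarUnitary Λ).map F)).IsHermitian := by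
  ext x y
  rw [Matrix.conjTranspose_apply, momentOp_map_apply t hF, momentOp_map_apply t hF,
    Complex.star_def, ← integral_conj]
  refine integral_congr_ae (Filter.Eventually.of_forall fun U => ?_)
  have h := congrFun (congrFun (tensorPow_conjTranspose t (F U)) x) y
  rw [(hH U).eq, Matrix.conjTranspose_apply] at h
  exact h.symm

lemma trace_momentOp_map_mul {n : ℕ} (t : ℕ) {F : Matrix.unitaryGroup Λ ℂ → QubitOp n}
    (hF : Continuous F) (S : Matrix (Fin t → Qubits n) (Fin t → Qubits n) ℂ) :
    (momentOp t ((haarUnitary Λ).map F) * S).trace =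
      ∫ U, (tensorPow t (F U) * S).trace ∂haarUnitary Λ := by
  have hi : ∀ x y, Integrable (fun U => tensorPow t (F U) x y * S y x) (haarUnitary Λ) := fun x y =>
    (integrable_haarUnitary (((continuous_tensorPow t).comp hF).matrix_elem x y)).mul_const _
  simp only [Matrix.trace, Matrix.diag_apply, Matrix.mul_apply]
  rw [integral_finsetSum _ fun x _ => integrable_finsetSum _ fun y _ => hi x y]
  refine Finset.sum_congr rfl fun x _ => ?_
  rw [integral_finsetSum _ fun y _ => hi x y]
  refine Finset.sum_congr rfl fun y _ => ?_
  rw [integral_mul_const, momentOp_map_apply t hF]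

open scoped ComplexOrder in
lemma norm_trace_momentOp_map_mul_le_one {n : ℕ} (t : ℕ)
    {F : Matrix.unitaryGroup Λ ℂ → QubitOp n} (hF : Continuous F)
    (hpos : ∀ U, (F U).PosSemidef) (htr : ∀ U, (F U).trace = 1)
    {S : Matrix (Fin t → Qubits n) (Fin t → Qubits n) ℂ}
    (hS : S ∈ Matrix.unitaryGroup (Fin t → Qubits n) ℂ) :
    ‖(momentOp t ((haarUnitary Λ).map F) * S).trace‖ ≤ 1 := by
  rw [trace_momentOp_map_mul t hF]
  refine (norm_integral_le_of_norm_le_const (C := 1) (Filter.Eventually.of_forall fun U =>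
    norm_trace_tensorPow_mul_le_one t (hpos U) (htr U) hS)).trans (by rw [probReal_univ, mul_one])

/-- The reduced state `tr_m |ψ⟩⟨ψ|`, where `ψ` is the first column of `V`. -/
def reducedState (n m : ℕ) (V : Matrix.unitaryGroup (Qubits (n + m)) ℂ) : QubitOp n :=
  columnMatrix (splitQubits n m) 0 (V : QubitOp (n + m)) *
    (columnMatrix (splitQubits n m) 0 (V : QubitOp (n + m))).conjTranspose

open scoped ComplexOrder in
lemma posSemidef_reducedState (n m : ℕ) (V : Matrix.unitaryGroup (Qubits (n + m)) ℂ) :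
    (reducedState n m V).PosSemidef :=
  Matrix.posSemidef_self_mul_conjTranspose _

lemma continuous_reducedState (n m : ℕ) : Continuous (reducedState n m) :=
  (continuous_columnMatrix _ _).matrix_mul (continuous_columnMatrix _ _).matrix_conjTranspose

/-- Applying `V` to the zero ket selects column `0`, and the partial trace of its projector is `G
Gᴴ` for the reshaped column `G`. -/
lemma ghse_eq_map (n m : ℕ) :
    ghse n m = (haarUnitary (Qubits (n + m))).map (reducedState n m) := by
  rw [ghse, haarState, Measure.map_map (measurable_ghse_map n m) (measurable_haarState_map _)]
  congr 1
  ext V x y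
  simp [reducedState, partialTraceLast, ketbra, Matrix.vecMulVec_apply, Matrix.mul_apply,
    columnMatrix, zeroKet, Matrix.mulVec_single]

/-- The inclusion of the last `m` of `n` qubits, the others being in the state `0`. -/
def padZero {n m : ℕ} (h : m ≤ n) (a : Qubits m) : Qubits n :=
  fun i => (splitQubits (n - m) m).symm (0, a) (Fin.cast (Nat.sub_add_cancel h).symm i)

lemma padZero_comp_cast {n m : ℕ} (h : m ≤ n) (x : Qubits n) (a : Qubits m) :
    x = padZero h a ↔
      splitQubits (n - m) m (fun i => x (Fin.cast (Nat.sub_add_cancel h) i)) = (0, a) := by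
  rw [← Equiv.eq_symm_apply]
  constructor
  · rintro rfl
    rfl
  · intro hx
    funext i
    exact congrFun hx (Fin.cast (Nat.sub_add_cancel h).symm i)

lemma padZero_injective {n m : ℕ} (h : m ≤ n) : Function.Injective (padZero h) := by
  intro a b hab
  have h1 := (padZero_comp_cast h (padZero h a) a).mp rfl
  have h2 := (padZero_comp_cast h (padZero h a) b).mp hab
  exact (Prod.mk.inj (h1.symm.trans h2)).2

/-- Puts the flat state in the form `P C Pᴴ` required by `norm_integral_trace_sub_le`. -/
lemma flatState_eq {n m : ℕ} (h : m ≤ n) :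
    flatState n m h = embeddingMatrix (padZero h) *
      (((Fintype.card (Qubits m) : ℂ))⁻¹ • (1 : QubitOp m)) *
        (embeddingMatrix (padZero h)).conjTranspose := by
  ext x y
  rw [embeddingMatrix_conj_apply]
  simp only [padZero_comp_cast]
  simp only [flatState, tensorOp, Matrix.submatrix_apply, Matrix.kroneckerMap_apply]
  generalize splitQubits (n - m) m (fun i => x (Fin.cast (Nat.sub_add_cancel h) i)) = p
  generalize splitQubits (n - m) m (fun i => y (Fin.cast (Nat.sub_add_cancel h) i)) = q
  obtain ⟨p1, p2⟩ := p
  obtain ⟨q1, q2⟩ := q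
  simp only [Prod.mk.injEq, ketbra, zeroKet, maxMixed, Matrix.vecMulVec_apply, Pi.star_apply,
    Pi.single_apply, Matrix.smul_apply, Matrix.one_apply, ite_and]
  by_cases hp : p1 = 0 <;> by_cases hq : q1 = 0 <;> simp [hp, hq]

lemma continuous_flatEnsemble_map {n m : ℕ} (h : m ≤ n) :
    Continuous fun U : Matrix.unitaryGroup (Qubits n) ℂ =>
      (U : QubitOp n) * flatState n m h * (U : QubitOp n).conjTranspose :=
  (continuous_subtype_val.matrix_mul continuous_const).matrix_mul
    continuous_subtype_val.matrix_conjTranspose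

open scoped ComplexOrder in
lemma posSemidef_flatState {n m : ℕ} (h : m ≤ n) : (flatState n m h).PosSemidef := by
  rw [flatState_eq]
  refine Matrix.PosSemidef.mul_mul_conjTranspose_same (Matrix.PosSemidef.one.smul ?_) _
  simp

open scoped ComplexOrder in
lemma posSemidef_conj_flatState {n m : ℕ} (h : m ≤ n) (U : Matrix.unitaryGroup (Qubits n) ℂ) :
    ((U : QubitOp n) * flatState n m h * (U : QubitOp n).conjTranspose).PosSemidef :=
  (posSemidef_flatState h).mul_mul_conjTranspose_same _

lemma trace_flatState {n m : ℕ} (h : m ≤ n) : (flatState n m h).trace = 1 := by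
  rw [flatState_eq, Matrix.mul_assoc, Matrix.trace_mul_comm, Matrix.mul_assoc,
    embeddingMatrix_conjTranspose_mul_self (padZero_injective h), Matrix.mul_one,
    Matrix.trace_smul, Matrix.trace_one, smul_eq_mul, inv_mul_cancel₀]
  exact_mod_cast Fintype.card_ne_zero

end Ensembles

/-! ### Assembly: the regimes `t² ≤ 2^n` and `t² > 2^n`. -/

theorem mainTheorem5 :
    ∃ C : ℝ, 0 < C ∧ ∀ (n m t : ℕ) (h : m ≤ n),
      traceNorm (momentOp t (ghse n m) - momentOp t (flatEnsemble n m h)) ≤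
        C * ((t : ℝ) ^ 2 / (2 : ℝ) ^ n) := by
  refine ⟨6, by norm_num, fun n m t h => ?_⟩
  have hpos := posSemidef_reducedState n m
  have hposF := posSemidef_conj_flatState h
  have hcF := continuous_flatEnsemble_map h
  have hcG := continuous_reducedState n m
  rw [ghse_eq_map, flatEnsemble]
  refine traceNorm_le_of_forall_unitary ((isHermitian_momentOp_map t hcG fun V => (hpos V).1).sub
    (isHermitian_momentOp_map t hcF fun U => (hposF U).1)) fun S hS => ?_
  rw [Matrix.sub_mul, Matrix.trace_sub]
  have hcard : ((Fintype.card (Qubits n) : ℕ) : ℝ) = 2 ^ n := by simp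
  by_cases ht : t ^ 2 ≤ Fintype.card (Qubits n)
  · rw [trace_momentOp_map_mul t hcG, trace_momentOp_map_mul t hcF, ← hcard]
    simp only [flatState_eq]
    exact (norm_integral_trace_sub_le (splitQubits n m) 0 (padZero_injective h) t hS _).trans
      (sum_norm_reducedMoment_sub_le _ _ t ht)
  -- Here `t ^ 2 / 2 ^ n` exceeds one, and two averages of states differ by at most 2 against any
  -- unitary.
  · have h1 := norm_trace_momentOp_map_mul_le_one t hcG hpos
      (fun V => trace_columnMatrix (splitQubits n m) 0 V) hS
    have h2 := norm_trace_momentOp_map_mul_le_one t hcF hposF (fun U => by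
      rw [Matrix.mul_assoc, Matrix.trace_mul_comm, Matrix.mul_assoc,
        ← Matrix.star_eq_conjTranspose, Matrix.mem_unitaryGroup_iff'.mp U.2, Matrix.mul_one,
        trace_flatState]) hS
    have h3 : (1 : ℝ) ≤ (t : ℝ) ^ 2 / 2 ^ n := by
      rw [one_le_div (by positivity), ← hcard]
      exact_mod_cast (not_le.mp ht).le
    exact (norm_sub_le _ _).trans (by linarith)
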